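/- **Setting.** A rectangular domain is a set $(a,b)\times(c,d)\subset\mathbb R^2$ with $a<b$, $c<d$ real. Let $L\ge 2$, let $\Omega_0,\dots,\Omega_L$ and $\Sigma_0,\dots,\Sigma_{L-1}$ be rectangular domains with $0\in\Sigma_l$, and put $\Omega:=\Omega_L$ and $\Omega_l' := \Omega_{l+1}-\Sigma_l=\{x-y : x\in\Omega_{l+1},\,y\in\Sigma_l\}$ for $0\le l\le L-1$. Let $\sigma:\mathbb R\to\mathbb R$ be Lipschitz continuous, $w^l\in L^2(\Sigma_l)$ and $b^l\in\mathbb R$ for $0\le l\le L-1$. *Reflection padding.* For a rectangular domain $\theta$, the repeated reflection of $\overline\theta$ across the edges tiles $\mathbb R^2$ by reflected copies of $\overline\theta$. For a function $u$ on $\overline\theta$, $\mathfrak R_{\theta,\Omega'}u$ is the restriction to $\Omega'$ of the extension of $u$ to $\mathbb R^2$ by this repeated reflection (one reflection across the edge $x_2=c$ is $u(x_1,|x_2-c|+c)$). For a finite signed Radon measure $\mu$ on $\overline\theta$, $\mathfrak R_{\theta,\Omega'}\mu$ is the restriction to $\Omega'$ of the measure that agrees with $\mu$ on $\overline\theta$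 and with the reflected copy of $\mu$ on every other tile, where each reflection adds a copy without the points on its axis, so that mass on an axis of reflection is counted once. *Convolution.* For $w\in L^2(\Sigma_l)$, with extension by zero $\tilde w$, and $x\in\Omega_{l+1}$ put $(u*w)(x)=\int_{\Sigma_l}w(y)\,u(x-y)\,dy$ for a function $u$ on $\Omega_l'$, and $(\nu*w)(x)=\int\tilde w(x-z)\,d\nu(z)$ (for almost every $x$) for a finite signed measure $\nu$ on $\Omega_l'$. *Network.* For a finite signed Radon measure $\mu$ on $\overline{\Omega_0}$ let $\mu^0=\mu$, $$\mu^{l+1}=\sigma\big((\mathfrak R_{\Omega_l,\Omega_l'}\mu^l)*w^l+b^l\big),\quad 0\le l\le L-2,\qquad \mathcal{NN}(\mu,w,b)=(\mathfrak R_{\Omega_{L-1},\Omega_{L-1}'}\mu^{L-1})*w^{L-1}+b^{L-1},$$ where $\sigma$ is applied pointwise. The output is a function on $\Omega$, determined up to equality almost everywhere. **Theorem (Regularity).** 1. For every finite signed Radon measure $\mu$ on $\overline{\Omega_0}$, $\mathcal{NN}(\mu,w,b)\in C(\overline\Omega)$. 2. If moreover $\mu\in \mathrm{BV}(\Omega_0)$,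 that is, $\mu=u\,dx$ with $u\in L^1(\Omega_0)$ whose distributional first derivatives are finite signed Radon measures on $\Omega_0$, then $\mathcal{NN}(\mu,w,b)\in C^1(\overline\Omega)$. Here $f\in C(\overline\Omega)$ means that $f$ agrees almost everywhere on $\Omega$ with a function that is continuous on $\overline\Omega$, and $f\in C^1(\overline\Omega)$ that it agrees almost everywhere on $\Omega$ with a function that is continuously differentiable in $\Omega$ and which, together with its first derivatives, extends continuously to $\overline\Omega$. -/

import Mathlib

open MeasureTheory Set
open scoped Pointwise ContDiff

noncomputable section

namespace FsCNN

/-- The plane `ℝ²`, with its product topology and Lebesgue measure `volume`. -/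
abbrev Plane : Type := ℝ × ℝ

/-- A rectangular domain: a non-empty set `(a, b) × (c, d)` with real end points. -/
structure Rect where
  a : ℝ
  b : ℝ
  c : ℝ
  d : ℝ
  hab : a < b
  hcd : c < d

/-- The open rectangle `(a, b) × (c, d)`. -/
def Rect.dom (R : Rect) : Set Plane := Ioo R.a R.b ×ˢ Ioo R.c R.d

/-! ### Extension by reflection -/

/-- The folding map `ℝ → [c, d]` of repeated reflection at the end points of `[c, d]`: the
distance of `t - c` to the nearest multiple of `2 (d - c)`, translated by `c`.
On `[c - (d - c), d]` it is `t ↦ |t - c| + c`. -/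
def fold (c d t : ℝ) : ℝ :=
  c + |(t - c) - 2 * (d - c) * (round ((t - c) / (2 * (d - c))) : ℝ)|

/-- The folding map of the plane onto the closed rectangle, obtained by folding both coordinates. -/
def Rect.fold (R : Rect) (x : Plane) : Plane :=
  (FsCNN.fold R.a R.b x.1, FsCNN.fold R.c R.d x.2)

/-- Extension by reflection of a function `u` on the closed rectangle `R` to the set `Ω`
(extended by zero to the plane). -/
def reflectFun (R : Rect) (Ω : Set Plane) (u : Plane → ℝ) : Plane → ℝ :=
  Ω.indicator fun x => u (R.fold x)

/-- The `k`-th tile of the tiling of the line generated by `[c, d]`. The tile number `0` is the closed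
interval `[c, d]`; every reflection adds a copy without the end point on the axis of reflection,
so that the tiles are disjoint and cover the line. -/
def tile (c d : ℝ) (k : ℤ) : Set ℝ :=
  if k = 0 then Icc c d
  else if 0 < k then Ioc (c + k * (d - c)) (c + (k + 1) * (d - c))
  else Ico (c + k * (d - c)) (c + (k + 1) * (d - c))

/-- The isometry that carries `[c, d]` onto the closure of the `k`-th tile in the reflected tiling:
a translation for even `k`, a reflection for odd `k`. -/
def tileMap (c d : ℝ) (k : ℤ) (t : ℝ) : ℝ :=
  if Even k then t + k * (d - c) else 2 * c + (k + 1) * (d - c) - t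

/-- The tiles of the plane generated by the closed rectangle `R`. -/
def Rect.tile (R : Rect) (k : ℤ × ℤ) : Set Plane :=
  FsCNN.tile R.a R.b k.1 ×ˢ FsCNN.tile R.c R.d k.2

/-- The isometry that carries the closed rectangle onto the closure of the tile number `k`. -/
def Rect.tileMap (R : Rect) (k : ℤ × ℤ) (x : Plane) : Plane :=
  (FsCNN.tileMap R.a R.b k.1 x.1, FsCNN.tileMap R.c R.d k.2 x.2)

/-- Extension by reflection of a finite signed measure `μ` on the closed rectangle `R` to the set `Ω`:
on each tile it is the reflected copy of `μ`. For bounded `Ω` only finitely many summands are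
nonzero (see `finite_support_reflectMeasure`). -/
def reflectMeasure (R : Rect) (Ω : Set Plane) (μ : SignedMeasure Plane) : SignedMeasure Plane :=
  ∑ᶠ k : ℤ × ℤ, (μ.map (R.tileMap k)).restrict (R.tile k ∩ Ω)

/-! ### Convolution -/

/-- The valid convolution `u * w (x) = ∫_S w (y) u (x - y) dy` of functions, with kernel `w` on `S`. -/
def convFun (S : Set Plane) (u w : Plane → ℝ) (x : Plane) : ℝ :=
  ∫ y in S, w y * u (x - y)

/-- The valid convolution `x ↦ ∫ w̃ (x - z) dν(z)` of a finite signed measure `ν` and a kernel `w`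
on `S`, with `w̃` the extension of `w` by zero. (The integral converges for almost every `x`; as a
class of functions this is the convolution given by duality.) -/
def convMeasure (S : Set Plane) (ν : SignedMeasure Plane) (w : Plane → ℝ) (x : Plane) : ℝ :=
  ∫ᵛ z, S.indicator w (x - z) ∂•ν

/-! ### The network -/

/-- The padded domain `Ω_l' = Ω_{l+1} - Σ_l`. -/
def padded (Ω S : ℕ → Rect) (l : ℕ) : Set Plane := (Ω (l + 1)).dom - (S l).dom

/-- The pre-activation on `Ω_{l+1}`, that is, the result of convolution number `l` plus the bias
`b l`. The input of convolution `0` is the padded measure `μ`; the input of convolution `l + 1`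
is the padded activation `σ (preactivation l)`. -/
def preactivation (Ω S : ℕ → Rect) (σ : ℝ → ℝ) (w : ℕ → Plane → ℝ) (b : ℕ → ℝ)
    (μ : SignedMeasure Plane) : ℕ → Plane → ℝ
  | 0 => fun x =>
      convMeasure (S 0).dom (reflectMeasure (Ω 0) (padded Ω S 0) μ) (w 0) x + b 0
  | l + 1 => fun x =>
      convFun (S (l + 1)).dom
        (reflectFun (Ω (l + 1)) (padded Ω S (l + 1))
          fun z => σ (preactivation Ω S σ w b μ l z))
        (w (l + 1)) x + b (l + 1)

/-- The output, on `Ω_L`, of the function space CNN with `L ≥ 1` convolutional layers: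
no activation is applied after the last convolution. -/
def fsCNN (L : ℕ) (Ω S : ℕ → Rect) (σ : ℝ → ℝ) (w : ℕ → Plane → ℝ) (b : ℕ → ℝ)
    (μ : SignedMeasure Plane) : Plane → ℝ :=
  preactivation Ω S σ w b μ (L - 1)

/-! ### Function spaces -/

/-- The signed measure `μ` lives on the set `K`. For closed rectangles `K` this is `μ ∈ M(K)`. -/
def IsMeasureOn (K : Set Plane) (μ : SignedMeasure Plane) : Prop :=
  ∀ A : Set Plane, MeasurableSet A → Disjoint A K → μ A = 0

/-- `ν` is the distributional derivative of `u` on `Ω` in direction `e`. -/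
def HasDistribDeriv (Ω : Set Plane) (u : Plane → ℝ) (e : Plane) (ν : SignedMeasure Plane) : Prop :=
  ∀ φ : Plane → ℝ, ContDiff ℝ ∞ φ → HasCompactSupport φ → tsupport φ ⊆ Ω →
    ∫ x in Ω, u x * fderiv ℝ φ x e = -∫ᵛ x, φ x ∂•ν

/-- `u ∈ BV(Ω)`: `u ∈ L¹(Ω)` and its distributional partial derivatives are finite signed measures. -/
def MemBV (Ω : Set Plane) (u : Plane → ℝ) : Prop :=
  IntegrableOn u Ω ∧
    (∃ ν : SignedMeasure Plane, HasDistribDeriv Ω u (1, 0) ν) ∧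
    (∃ ν : SignedMeasure Plane, HasDistribDeriv Ω u (0, 1) ν)

/-- The class of `f` modulo equality almost everywhere on `Ω` lies in `C(closure Ω)`. -/
def MemC (Ω : Set Plane) (f : Plane → ℝ) : Prop :=
  ∃ g : Plane → ℝ, ContinuousOn g (closure Ω) ∧ f =ᵐ[volume.restrict Ω] g

/-- The class of `f` modulo equality almost everywhere on `Ω` lies in `C¹(closure Ω)`: a representative is
continuously differentiable in `Ω`, and it and its derivative extend continuously to `closure Ω`. -/
def MemC1 (Ω : Set Plane) (f : Plane → ℝ) : Prop :=
  ∃ (g : Plane → ℝ) (g' : Plane → Plane →L[ℝ] ℝ),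
    ContinuousOn g (closure Ω) ∧ ContinuousOn g' (closure Ω) ∧
    (∀ x ∈ Ω, HasFDerivAt g (g' x) x) ∧ f =ᵐ[volume.restrict Ω] g

/-! ### The sum in the reflection of measures is finite -/

theorem finite_tile_inter {c d : ℝ} (h : c < d) (r : ℝ) :
    {k : ℤ | (tile c d k ∩ Icc (-r) r).Nonempty}.Finite := by
  have hl : 0 < d - c := sub_pos.mpr h
  refine (Set.finite_Icc (⌊(-r - c) / (d - c)⌋ - 1) (⌈(r - c) / (d - c)⌉)).subset ?_
  rintro k ⟨t, ht, h1, h2⟩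
  have key : c + k * (d - c) ≤ t ∧ t ≤ c + (k + 1) * (d - c) := by
    unfold tile at ht
    split_ifs at ht with h0 h3
    · subst h0
      simp only [mem_Icc] at ht
      constructor <;> push_cast <;> nlinarith [ht.1, ht.2]
    · exact ⟨ht.1.le, ht.2⟩
    · exact ⟨ht.1, ht.2.le⟩
  have e1 : (k : ℝ) ≤ (r - c) / (d - c) := by rw [le_div_iff₀ hl]; linarith [key.1]
  have e2 : (-r - c) / (d - c) ≤ ((k + 1 : ℤ) : ℝ) := by
    rw [div_le_iff₀ hl]; push_cast; linarith [key.2]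
  constructor
  · have := (Int.floor_le_floor e2); rw [Int.floor_intCast] at this; lia
  · have := (Int.ceil_le_ceil e1); rwa [Int.ceil_intCast] at this

theorem finite_support_reflectMeasure (R : Rect) {Ω : Set Plane} (hΩ : Bornology.IsBounded Ω)
    (μ : SignedMeasure Plane) :
    (Function.support fun k : ℤ × ℤ =>
      (μ.map (R.tileMap k)).restrict (R.tile k ∩ Ω)).Finite := by
  obtain ⟨r, hr⟩ := hΩ.subset_closedBall 0
  refine ((finite_tile_inter R.hab r).prod (finite_tile_inter R.hcd r)).subset ?_
  intro k hk
  have hne : (R.tile k ∩ Ω).Nonempty := by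
    by_contra hne
    rw [Set.not_nonempty_iff_eq_empty] at hne
    exact hk (by simp only [hne, VectorMeasure.restrict_empty])
  obtain ⟨x, ⟨hx1, hx2⟩, hx⟩ := hne
  have hb := hr hx
  rw [mem_closedBall_zero_iff, Prod.norm_def, max_le_iff, Real.norm_eq_abs, Real.norm_eq_abs,
    abs_le, abs_le] at hb
  exact ⟨⟨x.1, hx1, hb.1⟩, ⟨x.2, hx2, hb.2⟩⟩

end FsCNN

end

/-!
Regularity of function space CNNs.

The mechanism is that the convolution of two square-integrable functions is continuous. Young's
inequality for measures makes the first pre-activation square-integrable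
(`exists_locSquareIntegrable_convMeasure`), Lipschitz activations and reflection padding keep functions
locally square-integrable, and every later convolution is then continuous
(`IsKernel.continuous_conv`). On the output domain of a layer, the padded domain is exactly what the
kernel can reach, so the restriction to it can be dropped and all convolutions are taken over the
whole plane (`convFun_reflectFun_eq`).

For inputs of bounded variation the property that propagates is a bound for translations in `L^p`,
`‖U(· + h) - U‖_p = O(‖h‖)` on balls (`TranslationBound`), with `p = 1` before and `p = 2` after the
first convolution. This replaces weak derivatives, and hence the chain rule for Lipschitz functions.

* Functions of bounded variation have the bound for `p = 1` inside the rectangle: mollify, integrate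
  the derivative along segments, and pass to the limit with Fatou's lemma
  (`lintegral_sub_le_of_hasDistribDeriv`).
* The extension by reflection inherits the bound (`EnergyBound.comp_fold`). The folding map does not
  increase distances but does not commute with translations, so the bound is first rewritten as a bound
  for the nonlocal energy `∫∫_{|x - z| ≤ t} |f x - f z|^p`, which only sees distances.
* Convolution with an `L²` kernel takes the bound for `p = 1` to the bound for `p = 2`
  (`IsKernel.translationBound_conv`), and Lipschitz activations preserve it.
* The convolution of an `L²` kernel `w` and a function `U` with the bound for `p = 2` is `C¹`
  (`IsKernel.exists_hasFDerivAt_conv`): for smooth `w` the derivative is at most a constant times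
  `‖w‖₂`, so approximating `w` by smooth kernels gives derivatives that converge locally uniformly.
  A `C¹` function has the bound for `p = 2` again, which closes the induction over the layers.
-/

namespace FsCNN

open Filter Topology ENNReal

/-! ### Geometry of the folding map -/

theorem abs_sub_lattice {l : ℝ} (hl : 0 < l) (s : ℝ) (m : ℤ) :
    |s - l * m| = l * |s / l - m| := by
  have h : s - l * m = l * (s / l - m) := by rw [mul_sub, mul_div_cancel₀ _ hl.ne']
  rw [h, abs_mul, abs_of_pos hl]

/-- The folding map is the distance to the lattice `c + 2 (d - c) ℤ`, so it lies below the distance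
to every lattice point. -/
theorem fold_le_abs {c d : ℝ} (h : c < d) (t : ℝ) (n : ℤ) :
    fold c d t ≤ c + |(t - c) - 2 * (d - c) * n| := by
  have hl : 0 < 2 * (d - c) := by linarith
  unfold fold
  rw [abs_sub_lattice hl, abs_sub_lattice hl]
  have := mul_le_mul_of_nonneg_left (round_le ((t - c) / (2 * (d - c))) n) hl.le
  linarith

theorem fold_mem {c d : ℝ} (h : c < d) (t : ℝ) : fold c d t ∈ Icc c d := by
  have hl : 0 < 2 * (d - c) := by linarith
  refine ⟨le_add_of_nonneg_right (abs_nonneg _), ?_⟩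
  have h1 := abs_sub_round ((t - c) / (2 * (d - c)))
  unfold fold
  rw [abs_sub_lattice hl]
  nlinarith

theorem abs_fold_sub_fold_le {c d : ℝ} (h : c < d) (s t : ℝ) :
    |fold c d s - fold c d t| ≤ |s - t| := by
  have key : ∀ s t : ℝ, fold c d s - fold c d t ≤ |s - t| := by
    intro s t
    have h1 := fold_le_abs h s (round ((t - c) / (2 * (d - c))))
    have h2 := abs_add_le (s - t) (t - c - 2 * (d - c) * (round ((t - c) / (2 * (d - c))) : ℝ))
    have h3 : s - t + (t - c - 2 * (d - c) * (round ((t - c) / (2 * (d - c))) : ℝ)) =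
      s - c - 2 * (d - c) * (round ((t - c) / (2 * (d - c))) : ℝ) := by ring
    rw [h3] at h2
    have h4 : fold c d t = c + |t - c - 2 * (d - c) * (round ((t - c) / (2 * (d - c))) : ℝ)| := rfl
    linarith
  rw [abs_le]
  constructor
  · have := key t s
    rw [abs_sub_comm] at this
    linarith
  · exact key s t

theorem fold_tileMap {c d : ℝ} (h : c < d) (k : ℤ) {t : ℝ} (ht : t ∈ Icc c d) :
    fold c d (tileMap c d k t) = t := by
  have hl : 0 < d - c := by linarith
  obtain ⟨h1, h2⟩ := ht
  -- the image of `t` has distance `t - c` to the lattice point number `m`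
  have aux : ∀ (s : ℝ) (m : ℤ), (s - c - 2 * (d - c) * m = t - c ∨
      s - c - 2 * (d - c) * m = -(t - c)) → fold c d s = t := by
    intro s m hs
    apply le_antisymm
    · have := fold_le_abs h s m
      have h3 : |s - c - 2 * (d - c) * m| = t - c := by
        rcases hs with hs | hs
        · rw [hs, abs_of_nonneg (by linarith)]
        · rw [hs, abs_neg, abs_of_nonneg (by linarith)]
      linarith
    · unfold fold
      set n := round ((s - c) / (2 * (d - c)))
      suffices t - c ≤ |s - c - 2 * (d - c) * n| by linarith
      have h5 : s - c - 2 * (d - c) * n = (s - c - 2 * (d - c) * m) + 2 * (d - c) * (m - n) := by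
        ring
      have h6 : (m : ℝ) = n ∨ (m : ℝ) - n ≤ -1 ∨ 1 ≤ (m : ℝ) - n := by
        rcases lt_trichotomy m n with h | h | h
        · right; left
          have : (m : ℝ) + 1 ≤ n := by exact_mod_cast h
          linarith
        · left; rw [h]
        · right; right
          have : (n : ℝ) + 1 ≤ m := by exact_mod_cast h
          linarith
      rw [h5]
      rcases h6 with h6 | h6 | h6
      · rw [h6, sub_self, mul_zero, add_zero, ← h6]
        rcases hs with hs | hs <;> rw [hs]
        · exact le_abs_self _
        · rw [abs_neg]; exact le_abs_self _
      · rw [le_abs]; right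
        rcases hs with hs | hs <;> rw [hs] <;> nlinarith
      · rw [le_abs]; left
        rcases hs with hs | hs <;> rw [hs] <;> nlinarith
  unfold tileMap
  split_ifs with hk
  · obtain ⟨m, rfl⟩ := hk
    exact aux _ m (Or.inl (by push_cast; ring))
  · obtain ⟨m, rfl⟩ := Int.not_even_iff_odd.mp hk
    exact aux _ (m + 1) (Or.inr (by push_cast; ring))

theorem tile_subset_Icc (c d : ℝ) (k : ℤ) :
    tile c d k ⊆ Icc (c + k * (d - c)) (c + (k + 1) * (d - c)) := by
  unfold tile
  split_ifs with h0 h1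
  · subst h0
    intro t ht
    constructor <;> push_cast <;> linarith [ht.1, ht.2]
  · exact Ioc_subset_Icc_self
  · exact Ico_subset_Icc_self

theorem mem_Icc_of_tileMap_mem {c d : ℝ} {k : ℤ} {t : ℝ}
    (ht : tileMap c d k t ∈ tile c d k) : t ∈ Icc c d := by
  have := tile_subset_Icc c d k ht
  unfold tileMap at this
  split_ifs at this <;> constructor <;> nlinarith [this.1, this.2]

theorem exists_mem_tile {c d : ℝ} (h : c < d) (t : ℝ) : ∃ k, t ∈ tile c d k := by
  have hl : 0 < d - c := by linarith
  by_cases h0 : t ∈ Icc c d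
  · exact ⟨0, by simpa [tile] using h0⟩
  by_cases h1 : t < c
  · refine ⟨⌊(t - c) / (d - c)⌋, ?_⟩
    have hneg : ⌊(t - c) / (d - c)⌋ < 0 := by
      rw [Int.floor_lt, Int.cast_zero]
      exact div_neg_of_neg_of_pos (by linarith) hl
    rw [tile, if_neg hneg.ne, if_neg (not_lt.mpr hneg.le)]
    have e1 := Int.floor_le ((t - c) / (d - c))
    have e2 := Int.lt_floor_add_one ((t - c) / (d - c))
    rw [le_div_iff₀ hl] at e1
    rw [div_lt_iff₀ hl] at e2
    constructor <;> linarith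
  · have h2 : d < t := by
      by_contra h3
      exact h0 ⟨not_lt.mp h1, not_lt.mp h3⟩
    refine ⟨⌈(t - c) / (d - c)⌉ - 1, ?_⟩
    have hpos : 0 < ⌈(t - c) / (d - c)⌉ - 1 := by
      rw [sub_pos, Int.lt_ceil, Int.cast_one, one_lt_div hl]
      linarith
    rw [tile, if_neg hpos.ne', if_pos hpos]
    have e1 := Int.le_ceil ((t - c) / (d - c))
    have e2 := Int.ceil_lt_add_one ((t - c) / (d - c))
    rw [div_le_iff₀ hl] at e1
    rw [← sub_lt_iff_lt_add, lt_div_iff₀ hl] at e2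
    push_cast
    constructor <;> linarith

theorem tile_disjoint {c d : ℝ} (h : c < d) {j k : ℤ} (hjk : j ≠ k) :
    Disjoint (tile c d j) (tile c d k) := by
  have hl : 0 < d - c := by linarith
  wlog hlt : j < k generalizing j k
  · exact (this hjk.symm (lt_of_le_of_ne (not_lt.mp hlt) hjk.symm)).symm
  rw [Set.disjoint_left]
  intro t htj htk
  have h1 := (tile_subset_Icc c d j htj).2
  have h2 := (tile_subset_Icc c d k htk).1
  -- neighbouring tiles meet at most in the axis between them, which belongs to only one of them
  have h3 : k ≤ j + 1 := by
    by_contra hcon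
    have h4 : (j : ℝ) + 2 ≤ k := by exact_mod_cast (by lia : j + 2 ≤ k)
    nlinarith
  obtain rfl : k = j + 1 := by lia
  push_cast at h2
  have h5 : t = c + (j + 1) * (d - c) := le_antisymm h1 h2
  by_cases hj : j < 0
  · rw [tile, if_neg hj.ne, if_neg (not_lt.mpr hj.le)] at htj
    exact absurd htj.2 (by rw [h5]; exact lt_irrefl _)
  · have hj' : 0 < j + 1 := by lia
    rw [tile, if_neg hj'.ne', if_pos hj'] at htk
    have := htk.1
    push_cast at this
    linarith

theorem measurableSet_tile (c d : ℝ) (k : ℤ) : MeasurableSet (tile c d k) := by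
  unfold tile
  split_ifs
  exacts [measurableSet_Icc, measurableSet_Ioc, measurableSet_Ico]

theorem measurePreserving_tileMap (c d : ℝ) (k : ℤ) :
    MeasurePreserving (tileMap c d k) volume volume := by
  unfold tileMap
  split_ifs
  · exact measurePreserving_add_right volume _
  · exact Measure.measurePreserving_sub_left volume _

theorem measurableEmbedding_tileMap (c d : ℝ) (k : ℤ) : MeasurableEmbedding (tileMap c d k) := by
  unfold tileMap
  split_ifs
  · exact measurableEmbedding_addRight _
  · exact (MeasurableEquiv.subLeft _).measurableEmbedding

namespace Rect

variable (R : Rect)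

/-- The closed rectangle. -/
def cl : Set Plane := Icc R.a R.b ×ˢ Icc R.c R.d

theorem measurableSet_dom : MeasurableSet R.dom := measurableSet_Ioo.prod measurableSet_Ioo

theorem isOpen_dom : IsOpen R.dom := isOpen_Ioo.prod isOpen_Ioo

theorem convex_dom : Convex ℝ R.dom := (convex_Ioo _ _).prod (convex_Ioo _ _)

theorem dom_ae_eq_cl : R.dom =ᵐ[volume] R.cl := by
  rw [Measure.volume_eq_prod]
  exact Measure.set_prod_ae_eq Ioo_ae_eq_Icc Ioo_ae_eq_Icc

theorem isBounded_dom : Bornology.IsBounded R.dom :=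
  (Metric.isBounded_Ioo _ _).prod (Metric.isBounded_Ioo _ _)

theorem fold_mem_cl (x : Plane) : R.fold x ∈ R.cl := ⟨fold_mem R.hab _, fold_mem R.hcd _⟩

theorem norm_fold_sub_fold_le (x y : Plane) : ‖R.fold x - R.fold y‖ ≤ ‖x - y‖ := by
  rw [Prod.norm_def, Prod.norm_def]
  exact max_le_max (abs_fold_sub_fold_le R.hab _ _) (abs_fold_sub_fold_le R.hcd _ _)

theorem continuous_fold : Continuous R.fold := by
  have : LipschitzWith 1 R.fold := LipschitzWith.of_dist_le_mul fun x y => by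
    rw [NNReal.coe_one, one_mul, dist_eq_norm, dist_eq_norm]
    exact R.norm_fold_sub_fold_le x y
  exact this.continuous

theorem fold_tileMap (k : ℤ × ℤ) {x : Plane} (hx : x ∈ R.cl) : R.fold (R.tileMap k x) = x :=
  Prod.ext (FsCNN.fold_tileMap R.hab k.1 hx.1) (FsCNN.fold_tileMap R.hcd k.2 hx.2)

theorem preimage_tile_subset (k : ℤ × ℤ) : R.tileMap k ⁻¹' R.tile k ⊆ R.cl :=
  fun _ hx => ⟨mem_Icc_of_tileMap_mem hx.1, mem_Icc_of_tileMap_mem hx.2⟩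

theorem measurableSet_tile (k : ℤ × ℤ) : MeasurableSet (R.tile k) :=
  (FsCNN.measurableSet_tile _ _ _).prod (FsCNN.measurableSet_tile _ _ _)

theorem measurePreserving_tileMap (k : ℤ × ℤ) : MeasurePreserving (R.tileMap k) volume volume :=
  (FsCNN.measurePreserving_tileMap R.a R.b k.1).prod (FsCNN.measurePreserving_tileMap R.c R.d k.2)

theorem measurableEmbedding_tileMap (k : ℤ × ℤ) : MeasurableEmbedding (R.tileMap k) :=
  (FsCNN.measurableEmbedding_tileMap R.a R.b k.1).prodMap
    (FsCNN.measurableEmbedding_tileMap R.c R.d k.2)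

theorem tile_disjoint {j k : ℤ × ℤ} (hjk : j ≠ k) : Disjoint (R.tile j) (R.tile k) := by
  unfold tile
  rw [Set.disjoint_prod]
  by_cases h : j.1 = k.1
  · exact Or.inr (FsCNN.tile_disjoint R.hcd fun h' => hjk (Prod.ext h h'))
  · exact Or.inl (FsCNN.tile_disjoint R.hab h)

/-- A bounded set meets only finitely many tiles. -/
theorem exists_finset_tiles {A : Set Plane} (hA : Bornology.IsBounded A) :
    ∃ K : Finset (ℤ × ℤ), A ⊆ (⋃ k ∈ K, R.tile k) ∧ ∀ k ∉ K, R.tile k ∩ A = ∅ := by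
  obtain ⟨r, hr⟩ := hA.subset_closedBall 0
  have hfin := (finite_tile_inter R.hab r).prod (finite_tile_inter R.hcd r)
  have hmem : ∀ k x, x ∈ R.tile k → x ∈ A → k ∈ hfin.toFinset := by
    intro k x hxk hxA
    have hb := hr hxA
    rw [mem_closedBall_zero_iff, Prod.norm_def, max_le_iff, Real.norm_eq_abs, Real.norm_eq_abs,
      abs_le, abs_le] at hb
    rw [Set.Finite.mem_toFinset]
    exact ⟨⟨x.1, hxk.1, hb.1⟩, ⟨x.2, hxk.2, hb.2⟩⟩
  refine ⟨hfin.toFinset, fun x hx => ?_, fun k hk => ?_⟩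
  · obtain ⟨k1, hk1⟩ := exists_mem_tile R.hab x.1
    obtain ⟨k2, hk2⟩ := exists_mem_tile R.hcd x.2
    have hxk : x ∈ R.tile (k1, k2) := ⟨hk1, hk2⟩
    exact mem_iUnion₂.mpr ⟨_, hmem _ x hxk hx, hxk⟩
  · rw [← Set.not_nonempty_iff_eq_empty]
    rintro ⟨x, hx1, hx2⟩
    exact hk (hmem k x hx1 hx2)

/-! ### Change of variables under the folding map -/

/-- Integrals over bounded sets of functions extended by reflection are controlled by integrals over
the rectangle, since each of the finitely many tiles is an isometric copy of it. -/
theorem exists_lintegral_fold_le {A : Set Plane} (hA : Bornology.IsBounded A) :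
    ∃ N : NNReal, ∀ F : Plane → ℝ≥0∞,
      ∫⁻ x in A, F (R.fold x) ≤ N * ∫⁻ x in R.dom, F x := by
  obtain ⟨K, hK, -⟩ := R.exists_finset_tiles hA
  refine ⟨K.card, fun F => ?_⟩
  calc ∫⁻ x in A, F (R.fold x)
      ≤ ∫⁻ x in ⋃ k ∈ K, R.tile k, F (R.fold x) := lintegral_mono_set hK
    _ ≤ ∑ k ∈ K, ∫⁻ x in R.tile k, F (R.fold x) := by
        rw [← Finset.tsum_subtype]
        have : (⋃ k ∈ K, R.tile k) = ⋃ k : K, R.tile k := by ext; simp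
        rw [this]
        exact lintegral_iUnion_le _ _
    _ ≤ ∑ k ∈ K, ∫⁻ x in R.dom, F x := by
        refine Finset.sum_le_sum fun k _ => ?_
        rw [← (R.measurePreserving_tileMap k).setLIntegral_comp_preimage_emb
          (R.measurableEmbedding_tileMap k), setLIntegral_congr R.dom_ae_eq_cl]
        have hm : MeasurableSet (R.tileMap k ⁻¹' R.tile k) :=
          (R.measurePreserving_tileMap k).measurable (R.measurableSet_tile k)
        rw [setLIntegral_congr_fun (g := F) hm fun x hx => by
          simp only [R.fold_tileMap k (R.preimage_tile_subset k hx)]]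
        exact lintegral_mono_set (R.preimage_tile_subset k)
    _ = _ := by simp

theorem ae_fold {P : Plane → Prop} (h : ∀ᵐ x ∂volume.restrict R.dom, P x) :
    ∀ᵐ x, P (R.fold x) := by
  rw [ae_iff] at h
  set T := toMeasurable (volume.restrict R.dom) {x | ¬ P x}
  have hT : (volume.restrict R.dom) T = 0 := by rw [measure_toMeasurable, h]
  have hTm : MeasurableSet T := measurableSet_toMeasurable _ _
  suffices hs : ∀ n : ℕ, volume ((R.fold ⁻¹' T) ∩ Metric.closedBall 0 n) = 0 by
    rw [ae_iff]
    refine measure_mono_null ?_ (measure_iUnion_null hs)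
    intro x hx
    obtain ⟨n, hn⟩ := exists_nat_ge ‖x‖
    exact mem_iUnion.mpr ⟨n, subset_toMeasurable _ _ hx, by simpa using hn⟩
  intro n
  obtain ⟨N, hN⟩ := R.exists_lintegral_fold_le (Metric.isBounded_closedBall (x := (0 : Plane)) (r := n))
  have h1 := hN (T.indicator 1)
  rw [lintegral_indicator_one hTm, hT, mul_zero] at h1
  have hTm' : MeasurableSet (R.fold ⁻¹' T) := R.continuous_fold.measurable hTm
  have h2 : (fun x => T.indicator (1 : Plane → ℝ≥0∞) (R.fold x)) = (R.fold ⁻¹' T).indicator 1 := by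
    rfl
  rw [h2, lintegral_indicator_one hTm', Measure.restrict_apply hTm'] at h1
  exact le_antisymm h1 (zero_le)

end Rect

/-! ### Reflection of measures with a density -/

theorem integrableOn_comp_fold (R : Rect) {u : Plane → ℝ} (hum : Measurable u)
    (hu : IntegrableOn u R.dom) {A : Set Plane} (hA : Bornology.IsBounded A) :
    IntegrableOn (fun x => u (R.fold x)) A := by
  refine ⟨(hum.comp R.continuous_fold.measurable).aestronglyMeasurable, ?_⟩
  obtain ⟨N, hN⟩ := R.exists_lintegral_fold_le hA
  exact (hN fun x => ‖u x‖ₑ).trans_lt (ENNReal.mul_lt_top (by simp) hu.2)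

/-- The reflection of a measure with density `u` has the reflected function as its density. -/
theorem reflectMeasure_withDensity (R : Rect) {u : Plane → ℝ} (hum : Measurable u)
    (hu : IntegrableOn u R.dom) {A : Set Plane} (hA : Bornology.IsBounded A)
    (hAm : MeasurableSet A) :
    reflectMeasure R A ((volume.restrict R.dom).withDensityᵥ u) =
      volume.withDensityᵥ (reflectFun R A u) := by
  obtain ⟨K, hK, hK'⟩ := R.exists_finset_tiles hA
  have hint : IntegrableOn (fun x => u (R.fold x)) A := integrableOn_comp_fold R hum hu hA
  have hsum : reflectMeasure R A ((volume.restrict R.dom).withDensityᵥ u) =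
      ∑ k ∈ K, (((volume.restrict R.dom).withDensityᵥ u).map (R.tileMap k)).restrict
        (R.tile k ∩ A) := by
    apply finsum_eq_sum_of_support_subset
    intro k hk
    by_contra hkK
    exact hk (by simp only [hK' k (by simpa using hkK), VectorMeasure.restrict_empty])
  rw [hsum]
  ext E hE
  have hterm : ∀ k : ℤ × ℤ, (((volume.restrict R.dom).withDensityᵥ u).map (R.tileMap k)).restrict
      (R.tile k ∩ A) E = ∫ x in R.tile k ∩ (E ∩ A), u (R.fold x) := by
    intro k
    have hT := R.measurePreserving_tileMap k
    have hm : MeasurableSet (R.tile k ∩ (E ∩ A)) := (R.measurableSet_tile k).inter (hE.inter hAm)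
    have hm' : MeasurableSet (R.tileMap k ⁻¹' (R.tile k ∩ (E ∩ A))) := hT.measurable hm
    have hsub : R.tileMap k ⁻¹' (R.tile k ∩ (E ∩ A)) ⊆ R.cl :=
      (preimage_mono inter_subset_left).trans (R.preimage_tile_subset k)
    have hset : E ∩ (R.tile k ∩ A) = R.tile k ∩ (E ∩ A) := by
      ext x; simp only [mem_inter_iff]; tauto
    rw [VectorMeasure.restrict_apply _ ((R.measurableSet_tile k).inter hAm) hE, hset,
      VectorMeasure.map_apply _ hT.measurable hm, withDensityᵥ_apply hu hm',
      Measure.restrict_restrict hm',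
      ← hT.setIntegral_preimage_emb (R.measurableEmbedding_tileMap k) (fun x => u (R.fold x))]
    have hae : (R.tileMap k ⁻¹' (R.tile k ∩ (E ∩ A)) ∩ R.dom : Set Plane) =ᵐ[volume]
        R.tileMap k ⁻¹' (R.tile k ∩ (E ∩ A)) := by
      have := (Filter.EventuallyEq.refl (ae volume)
        (R.tileMap k ⁻¹' (R.tile k ∩ (E ∩ A)))).inter R.dom_ae_eq_cl
      rwa [inter_eq_left.mpr hsub] at this
    rw [setIntegral_congr_set hae]
    exact setIntegral_congr_fun hm' fun x hx => by simp only [R.fold_tileMap k (hsub hx)]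
  have hcover : E ∩ A = ⋃ k ∈ K, R.tile k ∩ (E ∩ A) := by
    rw [← iUnion₂_inter]
    exact (inter_eq_right.mpr (inter_subset_right.trans hK)).symm
  have hind : Integrable (reflectFun R A u) := hint.integrable_indicator hAm
  rw [withDensityᵥ_apply hind hE]
  unfold reflectFun
  rw [setIntegral_indicator hAm]
  conv_rhs => rw [hcover]
  rw [integral_biUnion_finset K
    (fun k _ => (R.measurableSet_tile k).inter (hE.inter hAm))
    (fun j _ k _ hjk => (R.tile_disjoint hjk).mono inter_subset_left inter_subset_left)
    (fun k _ => hint.mono_set (inter_subset_right.trans inter_subset_right))]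
  simp only [sum_apply, hterm]

/-! ### Translation bounds, nonlocal energies and reflection -/

/-- `U` is locally `p`-integrably Lipschitz with respect to translations: on every ball,
`‖U(· + h) - U‖_p = O(‖h‖)` as `h → 0`. Among the functions that are locally in `L^p`, this
characterizes for `p = 1` those of locally bounded variation, and for `p = 2` those that are locally
in the Sobolev space `W^{1,2}`. -/
def TranslationBound (p : ℕ) (U : Plane → ℝ) : Prop :=
  ∀ r : ℝ, ∃ C : NNReal, ∀ᶠ h in 𝓝 (0 : Plane),
    ∫⁻ x in Metric.closedBall 0 r, ‖U (x + h) - U x‖ₑ ^ p ≤ C * ‖h‖ₑ ^ p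

/-- The nonlocal energy of `f` on `A` at scale `t`: the integral of `|f x - f z| ^ p` over the pairs of
points of `A` with distance at most `t`. -/
noncomputable def nonlocalEnergy (p : ℕ) (A : Set Plane) (f : Plane → ℝ) (t : ℝ) : ℝ≥0∞ :=
  ∫⁻ x in A, ∫⁻ z in A ∩ Metric.closedBall x t, ‖f x - f z‖ₑ ^ p

/-- The nonlocal energy decays at small scales like that of functions with first derivatives in `L^p`:
the domain of integration has measure of order `t ^ 2`, and `|f x - f z| ^ p` is of order `t ^ p`. -/
def EnergyBound (p : ℕ) (A : Set Plane) (f : Plane → ℝ) : Prop :=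
  ∃ C : NNReal, ∀ᶠ t in 𝓝[>] (0 : ℝ), nonlocalEnergy p A f t ≤ C * ENNReal.ofReal t ^ (p + 2)

theorem measurable_lintegral_inter_closedBall {p : ℕ} {A : Set Plane} (hA : MeasurableSet A)
    {f : Plane → ℝ} (hf : Measurable f) (t : ℝ) :
    Measurable fun x => ∫⁻ z in A ∩ Metric.closedBall x t, ‖f x - f z‖ₑ ^ p := by
  have h1 : MeasurableSet {q : Plane × Plane | q.2 ∈ A ∧ q.2 ∈ Metric.closedBall q.1 t} :=
    (measurable_snd hA).inter
      (measurableSet_le (measurable_snd.dist measurable_fst) measurable_const)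
  have h2 : Measurable fun q : Plane × Plane => ‖f q.1 - f q.2‖ₑ ^ p := by fun_prop
  have h3 := (h2.indicator h1).lintegral_prod_right' (ν := (volume : Measure Plane))
  convert h3 using 2 with x
  rw [← lintegral_indicator (hA.inter Metric.isClosed_closedBall.measurableSet)]
  rfl

theorem volume_closedBall_plane (t : ℝ) :
    volume (Metric.closedBall (0 : Plane) t) = ENNReal.ofReal (2 * t) ^ 2 := by
  have : Metric.closedBall (0 : Plane) t = Metric.closedBall (0 : ℝ) t ×ˢ Metric.closedBall (0 : ℝ) t :=
    (closedBall_prod_same _ _ _).symm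
  rw [this, Measure.volume_eq_prod, Measure.prod_prod, Real.volume_closedBall, sq]

/-- The energy at scale `t` is an integral of translation differences over all translations of length
at most `t`. -/
theorem nonlocalEnergy_le {p : ℕ} {A : Set Plane} (hA : MeasurableSet A) {f : Plane → ℝ}
    (hf : Measurable f) {t : ℝ} {M : ℝ≥0∞}
    (hM : ∀ k ∈ Metric.closedBall (0 : Plane) t,
      ∫⁻ x in A ∩ {x | x + k ∈ A}, ‖f (x + k) - f x‖ₑ ^ p ≤ M) :
    nonlocalEnergy p A f t ≤ M * ENNReal.ofReal (2 * t) ^ 2 := by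
  set B := Metric.closedBall (0 : Plane) t
  have hB : MeasurableSet B := Metric.isClosed_closedBall.measurableSet
  set D : Set (Plane × Plane) := {q | q.2 ∈ B ∧ q.1 + q.2 ∈ A}
  have hD : MeasurableSet D := (measurable_snd hB).inter
    ((measurable_fst.add measurable_snd) hA)
  set G : Plane × Plane → ℝ≥0∞ := D.indicator fun q => ‖f (q.1 + q.2) - f q.1‖ₑ ^ p
  have hG : Measurable G := Measurable.indicator (by fun_prop) hD
  have h1 : nonlocalEnergy p A f t = ∫⁻ x in A, ∫⁻ k, G (x, k) := by
    unfold nonlocalEnergy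
    refine lintegral_congr fun x => ?_
    rw [← lintegral_indicator (hA.inter Metric.isClosed_closedBall.measurableSet),
      ← lintegral_add_left_eq_self _ x]
    refine lintegral_congr fun k => ?_
    have hmem : x + k ∈ A ∩ Metric.closedBall x t ↔ (x, k) ∈ D := by
      simp [D, B, and_comm]
    by_cases hk : (x, k) ∈ D
    · rw [indicator_of_mem (hmem.mpr hk), ← enorm_neg, neg_sub]
      exact (indicator_of_mem hk fun q : Plane × Plane => ‖f (q.1 + q.2) - f q.1‖ₑ ^ p).symm
    · rw [indicator_of_notMem (mt hmem.mp hk)]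
      exact (indicator_of_notMem hk fun q : Plane × Plane => ‖f (q.1 + q.2) - f q.1‖ₑ ^ p).symm
  rw [h1, lintegral_lintegral_swap (f := fun x k => G (x, k)) hG.aemeasurable]
  calc ∫⁻ k, ∫⁻ x in A, G (x, k) ≤ ∫⁻ k, B.indicator (fun _ => M) k := by
        refine lintegral_mono fun k => ?_
        by_cases hk : k ∈ B
        · rw [indicator_of_mem hk]
          refine le_trans (le_of_eq ?_) (hM k hk)
          have hAk : MeasurableSet {x : Plane | x + k ∈ A} := (measurable_id.add_const k) hA
          rw [inter_comm, ← setLIntegral_indicator hAk]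
          refine lintegral_congr fun x => ?_
          by_cases hx : x + k ∈ A <;> simp [G, D, indicator, hk, hx]
        · rw [indicator_of_notMem hk]
          simp [G, D, hk]
    _ = M * ENNReal.ofReal (2 * t) ^ 2 := by
        rw [lintegral_indicator_const hB, volume_closedBall_plane]

theorem EnergyBound.of_translation {p : ℕ} {A : Set Plane} (hA : MeasurableSet A) {f : Plane → ℝ}
    (hf : Measurable f) {C : NNReal}
    (hC : ∀ᶠ k in 𝓝 (0 : Plane),
      ∫⁻ x in A ∩ {x | x + k ∈ A}, ‖f (x + k) - f x‖ₑ ^ p ≤ C * ‖k‖ₑ ^ p) :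
    EnergyBound p A f := by
  obtain ⟨δ, hδ, hC⟩ := Metric.eventually_nhds_iff.mp hC
  refine ⟨4 * C, ?_⟩
  filter_upwards [Ioo_mem_nhdsGT hδ] with t ht
  refine (nonlocalEnergy_le hA hf (M := C * ENNReal.ofReal t ^ p) fun k hk => ?_).trans ?_
  · rw [mem_closedBall_zero_iff] at hk
    refine (hC (by rw [dist_zero_right]; exact hk.trans_lt ht.2)).trans ?_
    gcongr
    rw [← ofReal_norm]
    exact ENNReal.ofReal_le_ofReal hk
  · rw [ENNReal.ofReal_mul two_pos.le, mul_pow, pow_add]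
    apply le_of_eq
    push_cast
    rw [ENNReal.ofReal_ofNat]
    ring

theorem EnergyBound.of_translationBound {p : ℕ} {A : Set Plane} (hA : MeasurableSet A)
    (hAb : Bornology.IsBounded A) {f : Plane → ℝ} (hf : Measurable f)
    (h : TranslationBound p f) : EnergyBound p A f := by
  obtain ⟨r, hr⟩ := hAb.subset_closedBall 0
  obtain ⟨C, hC⟩ := h r
  exact .of_translation hA hf (hC.mono fun k hk =>
    (lintegral_mono_set (inter_subset_left.trans hr)).trans hk)

theorem TranslationBound.comp_lipschitz {p : ℕ} {U : Plane → ℝ} (h : TranslationBound p U)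
    {σ : ℝ → ℝ} {K : NNReal} (hσ : LipschitzWith K σ) : TranslationBound p fun x => σ (U x) := by
  intro r
  obtain ⟨C, hC⟩ := h r
  refine ⟨K ^ p * C, hC.mono fun k hk => ?_⟩
  calc ∫⁻ x in Metric.closedBall 0 r, ‖σ (U (x + k)) - σ (U x)‖ₑ ^ p
      ≤ ∫⁻ x in Metric.closedBall 0 r, (K : ℝ≥0∞) ^ p * ‖U (x + k) - U x‖ₑ ^ p := by
        refine lintegral_mono fun x => ?_
        rw [← mul_pow]
        gcongr
        rw [← edist_eq_enorm_sub, ← edist_eq_enorm_sub]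
        exact hσ _ _
    _ = (K : ℝ≥0∞) ^ p * ∫⁻ x in Metric.closedBall 0 r, ‖U (x + k) - U x‖ₑ ^ p :=
        lintegral_const_mul' _ _ (by simp)
    _ ≤ _ := by
        push_cast
        rw [mul_assoc]
        gcongr

/-- Small balls around points of the closed rectangle meet the rectangle in a set of comparable
size. -/
theorem Rect.sq_le_volume_inter_closedBall (R : Rect) {x : Plane} (hx : x ∈ R.cl) {t : ℝ}
    (ht0 : 0 < t) (h1 : t ≤ R.b - R.a) (h2 : t ≤ R.d - R.c) :
    ENNReal.ofReal t ^ 2 ≤ volume (R.dom ∩ Metric.closedBall x t) := by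
  have key : ∀ a b y : ℝ, y ∈ Icc a b → t ≤ b - a →
      ENNReal.ofReal t ≤ volume (Ioo a b ∩ Metric.closedBall y t) := by
    intro a b y hy htab
    have hsub : Ioo (max a (y - t)) (min b (y + t)) ⊆ Ioo a b ∩ Metric.closedBall y t := by
      intro z hz
      rw [Real.closedBall_eq_Icc]
      exact ⟨⟨(le_max_left _ _).trans_lt hz.1, hz.2.trans_le (min_le_left _ _)⟩,
        ((le_max_right _ _).trans_lt hz.1).le, (hz.2.trans_le (min_le_right _ _)).le⟩
    refine le_trans ?_ (measure_mono hsub)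
    rw [Real.volume_Ioo]
    refine ENNReal.ofReal_le_ofReal ?_
    obtain ⟨hy1, hy2⟩ := hy
    rcases max_cases a (y - t) with h | h <;> rcases min_cases b (y + t) with h' | h' <;> linarith
  have hset : R.dom ∩ Metric.closedBall x t = (Ioo R.a R.b ∩ Metric.closedBall x.1 t) ×ˢ
      (Ioo R.c R.d ∩ Metric.closedBall x.2 t) := by
    rw [← closedBall_prod_same x.1 x.2 t, ← Set.prod_inter_prod]
    rfl
  rw [hset, Measure.volume_eq_prod, Measure.prod_prod, sq]
  gcongr
  · exact key _ _ _ hx.1 h1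
  · exact key _ _ _ hx.2 h2

theorem enorm_sub_pow_le (p : ℕ) (x y z : ℝ) :
    ‖x - y‖ₑ ^ p ≤ 2 ^ p * (‖x - z‖ₑ ^ p + ‖y - z‖ₑ ^ p) := by
  have h1 : ‖x - y‖ₑ ≤ ‖x - z‖ₑ + ‖y - z‖ₑ := by
    rw [← edist_eq_enorm_sub, ← edist_eq_enorm_sub, ← edist_eq_enorm_sub]
    exact edist_triangle_right _ _ _
  have h2 : ‖x - z‖ₑ + ‖y - z‖ₑ ≤ 2 * max ‖x - z‖ₑ ‖y - z‖ₑ := by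
    rw [two_mul]
    exact add_le_add (le_max_left _ _) (le_max_right _ _)
  calc ‖x - y‖ₑ ^ p ≤ (2 * max ‖x - z‖ₑ ‖y - z‖ₑ) ^ p := by gcongr; exact h1.trans h2
    _ = 2 ^ p * max (‖x - z‖ₑ ^ p) (‖y - z‖ₑ ^ p) := by
        rw [mul_pow]
        congr 1
        exact (pow_left_mono p).map_max
    _ ≤ _ := by
        gcongr
        exact max_le (le_add_right le_rfl) (le_add_left le_rfl)

/-- Extension by reflection turns an energy bound on the rectangle into a translation bound on the
plane. The values at the folded points `X` and `Y` of `x` and `x + h` are compared through all points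
of the rectangle near `X`: since the folding map does not increase distances, these lie within `‖h‖`
of `X` and within `2 ‖h‖` of `Y`. -/
theorem EnergyBound.comp_fold {p : ℕ} (hp : p ≠ 0) (R : Rect) {f : Plane → ℝ} (hf : Measurable f)
    (h : EnergyBound p R.dom f) : TranslationBound p fun x => f (R.fold x) := by
  intro r
  obtain ⟨C, hC⟩ := h
  obtain ⟨δ, hδ, hC⟩ := mem_nhdsGT_iff_exists_Ioo_subset.mp hC
  rw [mem_Ioi] at hδ
  obtain ⟨N, hN⟩ := R.exists_lintegral_fold_le
    (Metric.isBounded_closedBall (x := (0 : Plane)) (r := r + 1))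
  refine ⟨2 ^ p * N * (C + 2 ^ (p + 2) * C), ?_⟩
  have hpos : 0 < min (δ / 2) (min 1 (min (R.b - R.a) (R.d - R.c))) := by
    have := R.hab; have := R.hcd
    simp only [lt_min_iff]
    refine ⟨by linarith, one_pos, by linarith, by linarith⟩
  filter_upwards [Metric.ball_mem_nhds (0 : Plane) hpos] with h hh
  rw [mem_ball_zero_iff] at hh
  simp only [lt_min_iff] at hh
  obtain ⟨hh1, hh2, hh3, hh4⟩ := hh
  set t := ‖h‖ with ht
  rcases (norm_nonneg h).eq_or_lt with h0 | h0
  · have : h = 0 := norm_eq_zero.mp h0.symm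
    subst this
    simp [hp]
  set g : ℝ → Plane → ℝ≥0∞ := fun s x => ∫⁻ z in R.dom ∩ Metric.closedBall x s, ‖f x - f z‖ₑ ^ p
  have hgm : ∀ s, Measurable (g s) := fun s =>
    measurable_lintegral_inter_closedBall R.measurableSet_dom hf s
  have hpt : ∀ x, ENNReal.ofReal t ^ 2 * ‖f (R.fold (x + h)) - f (R.fold x)‖ₑ ^ p ≤
      2 ^ p * (g (2 * t) (R.fold (x + h)) + g t (R.fold x)) := by
    intro x
    set X := R.fold x
    set Y := R.fold (x + h)
    have hXY : dist X Y ≤ t := by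
      rw [dist_eq_norm]
      refine (R.norm_fold_sub_fold_le _ _).trans ?_
      simp [ht]
    set A := R.dom ∩ Metric.closedBall X t
    have hA : MeasurableSet A := R.measurableSet_dom.inter Metric.isClosed_closedBall.measurableSet
    calc ENNReal.ofReal t ^ 2 * ‖f Y - f X‖ₑ ^ p ≤ volume A * ‖f Y - f X‖ₑ ^ p := by
          gcongr
          exact R.sq_le_volume_inter_closedBall (R.fold_mem_cl x) h0 hh3.le hh4.le
      _ = ∫⁻ z in A, ‖f Y - f X‖ₑ ^ p := by rw [setLIntegral_const, mul_comm]
      _ ≤ ∫⁻ z in A, 2 ^ p * (‖f Y - f z‖ₑ ^ p + ‖f X - f z‖ₑ ^ p) :=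
          lintegral_mono fun z => enorm_sub_pow_le p _ _ _
      _ = 2 ^ p * ((∫⁻ z in A, ‖f Y - f z‖ₑ ^ p) + ∫⁻ z in A, ‖f X - f z‖ₑ ^ p) := by
          rw [lintegral_const_mul' _ _ (by simp), lintegral_add_left (by fun_prop)]
      _ ≤ 2 ^ p * (g (2 * t) Y + g t X) := by
          gcongr
          refine lintegral_mono_set (inter_subset_inter_right _ fun z hz => ?_)
          rw [Metric.mem_closedBall] at hz ⊢
          linarith [dist_triangle z X Y]
  have hball : ∀ F : Plane → ℝ≥0∞,
      ∫⁻ x in Metric.closedBall (0 : Plane) r, F (x + h) ≤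
        ∫⁻ x in Metric.closedBall (0 : Plane) (r + 1), F x := by
    intro F
    rw [← lintegral_indicator Metric.isClosed_closedBall.measurableSet,
      ← lintegral_indicator Metric.isClosed_closedBall.measurableSet,
      ← lintegral_add_right_eq_self ((Metric.closedBall (0 : Plane) (r + 1)).indicator F) h]
    refine lintegral_mono fun x => ?_
    by_cases hx : x ∈ Metric.closedBall (0 : Plane) r
    · have hx' : x + h ∈ Metric.closedBall (0 : Plane) (r + 1) := by
        rw [mem_closedBall_zero_iff] at hx ⊢
        linarith [norm_add_le x h]
      rw [indicator_of_mem hx, indicator_of_mem hx']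
    · rw [indicator_of_notMem hx]
      exact zero_le
  have hsum : ENNReal.ofReal t ^ 2 *
      ∫⁻ x in Metric.closedBall 0 r, ‖f (R.fold (x + h)) - f (R.fold x)‖ₑ ^ p ≤
      ENNReal.ofReal t ^ 2 * ((2 ^ p * N * (C + 2 ^ (p + 2) * C)) * ‖h‖ₑ ^ p) := by
    calc ENNReal.ofReal t ^ 2 *
          ∫⁻ x in Metric.closedBall 0 r, ‖f (R.fold (x + h)) - f (R.fold x)‖ₑ ^ p
        = ∫⁻ x in Metric.closedBall 0 r,
            ENNReal.ofReal t ^ 2 * ‖f (R.fold (x + h)) - f (R.fold x)‖ₑ ^ p :=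
          (lintegral_const_mul' _ _ (by finiteness)).symm
      _ ≤ ∫⁻ x in Metric.closedBall 0 r, 2 ^ p * (g (2 * t) (R.fold (x + h)) + g t (R.fold x)) :=
          lintegral_mono hpt
      _ = 2 ^ p * ((∫⁻ x in Metric.closedBall 0 r, g (2 * t) (R.fold (x + h))) +
            ∫⁻ x in Metric.closedBall 0 r, g t (R.fold x)) := by
          rw [lintegral_const_mul' _ _ (by simp), lintegral_add_right]
          exact (hgm t).comp R.continuous_fold.measurable
      _ ≤ 2 ^ p * (N * (C * ENNReal.ofReal (2 * t) ^ (p + 2)) +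
            N * (C * ENNReal.ofReal t ^ (p + 2))) := by
          gcongr
          · refine (hball fun x => g (2 * t) (R.fold x)).trans ((hN _).trans ?_)
            gcongr
            exact hC ⟨by linarith, by linarith⟩
          · refine (lintegral_mono_set (Metric.closedBall_subset_closedBall (by linarith))).trans
              ((hN _).trans ?_)
            gcongr
            exact hC ⟨h0, by linarith⟩
      _ = _ := by
          rw [← ofReal_norm h, ← ht, ENNReal.ofReal_mul two_pos.le, ENNReal.ofReal_ofNat]
          ring
  have h3 : ENNReal.ofReal t ^ 2 ≠ 0 := by
    simpa [ht] using h0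
  push_cast
  exact (ENNReal.mul_le_mul_iff_right h3 (by finiteness)).mp hsum

/-! ### Convolution with square-integrable kernels -/

theorem lintegral_mul_sq_le {α : Type*} [MeasurableSpace α] {m : Measure α} {f g : α → ℝ≥0∞}
    (hf : AEMeasurable f m) (hg : AEMeasurable g m) :
    (∫⁻ a, f a * g a ∂m) ^ 2 ≤ (∫⁻ a, f a ^ 2 ∂m) * ∫⁻ a, g a ^ 2 ∂m := by
  have h := ENNReal.lintegral_mul_le_Lp_mul_Lq m Real.HolderConjugate.two_two hf hg
  simp only [Pi.mul_apply, ENNReal.rpow_two] at h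
  calc (∫⁻ a, f a * g a ∂m) ^ 2
      ≤ ((∫⁻ a, f a ^ 2 ∂m) ^ (1 / 2 : ℝ) * (∫⁻ a, g a ^ 2 ∂m) ^ (1 / 2 : ℝ)) ^ 2 := by gcongr
    _ = _ := by
        rw [mul_pow, ← ENNReal.rpow_two, ← ENNReal.rpow_two, ← ENNReal.rpow_mul, ← ENNReal.rpow_mul]
        norm_num

theorem eLpNorm_two_sq {α : Type*} [MeasurableSpace α] {m : Measure α} (f : α → ℝ) :
    eLpNorm f 2 m ^ 2 = ∫⁻ a, ‖f a‖ₑ ^ 2 ∂m := by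
  rw [eLpNorm_eq_lintegral_rpow_enorm_toReal two_ne_zero ENNReal.ofNat_ne_top, ← ENNReal.rpow_two,
    ← ENNReal.rpow_mul]
  norm_num

theorem memLp_two_iff {α : Type*} [MeasurableSpace α] {m : Measure α} {f : α → ℝ} :
    MemLp f 2 m ↔ AEStronglyMeasurable f m ∧ ∫⁻ a, ‖f a‖ₑ ^ 2 ∂m < ⊤ := by
  rw [MemLp, ← eLpNorm_two_sq, ENNReal.pow_lt_top_iff]
  simp

/-- A square-integrable convolution kernel with support in the closed ball of radius `s`. -/
structure IsKernel (s : ℝ) (w : Plane → ℝ) : Prop where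
  measurable : Measurable w
  eq_zero : ∀ y, s < ‖y‖ → w y = 0
  lintegral_sq_lt_top : ∫⁻ y, ‖w y‖ₑ ^ 2 < ⊤

/-- A measurable function on the plane that is square-integrable on every ball. -/
structure LocSquareIntegrable (U : Plane → ℝ) : Prop where
  measurable : Measurable U
  lintegral_sq_lt_top : ∀ r : ℝ, ∫⁻ x in Metric.closedBall 0 r, ‖U x‖ₑ ^ 2 < ⊤

/-- The convolution of two functions on the plane. -/
noncomputable def conv (w U : Plane → ℝ) (x : Plane) : ℝ := ∫ y, w y * U (x - y)

theorem conv_eq_convolution (w U : Plane → ℝ) :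
    conv w U = convolution w U (ContinuousLinearMap.mul ℝ ℝ) volume := rfl

theorem LocSquareIntegrable.of_continuous {U : Plane → ℝ} (h : Continuous U) :
    LocSquareIntegrable U := by
  refine ⟨h.measurable, fun r => ?_⟩
  have h1 : Continuous fun x => ‖U x‖ₑ ^ 2 := by fun_prop
  obtain ⟨C, hC⟩ := ((isCompact_closedBall (0 : Plane) r).bddAbove_image
    (f := fun x => ‖U x‖) (by fun_prop))
  calc ∫⁻ x in Metric.closedBall 0 r, ‖U x‖ₑ ^ 2
      ≤ ∫⁻ x in Metric.closedBall (0 : Plane) r, ENNReal.ofReal C ^ 2 := by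
        refine setLIntegral_mono' Metric.isClosed_closedBall.measurableSet fun x hx => ?_
        rw [← ofReal_norm]
        gcongr
        exact hC ⟨x, hx, rfl⟩
    _ < ⊤ := by
        rw [setLIntegral_const]
        exact ENNReal.mul_lt_top (by finiteness) (isCompact_closedBall (0 : Plane) r).measure_lt_top

theorem LocSquareIntegrable.locallyIntegrable {U : Plane → ℝ} (h : LocSquareIntegrable U) :
    LocallyIntegrable U := by
  intro x
  refine ⟨Metric.closedBall 0 (‖x‖ + 1), ?_, ?_⟩
  · refine mem_of_superset (Metric.closedBall_mem_nhds x one_pos) fun y hy => ?_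
    rw [mem_closedBall_zero_iff]
    rw [Metric.mem_closedBall, dist_eq_norm] at hy
    linarith [norm_sub_norm_le y x]
  · have : IsFiniteMeasure (volume.restrict (Metric.closedBall (0 : Plane) (‖x‖ + 1))) :=
      ⟨by simpa using (isCompact_closedBall (0 : Plane) _).measure_lt_top⟩
    exact (memLp_two_iff.mpr ⟨h.measurable.aestronglyMeasurable,
      h.lintegral_sq_lt_top _⟩).integrable one_le_two

theorem IsKernel.sub {s : ℝ} {v w : Plane → ℝ} (hv : IsKernel s v) (hw : IsKernel s w) :
    IsKernel s (v - w) := by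
  refine ⟨hv.measurable.sub hw.measurable, fun y hy => ?_, ?_⟩
  · rw [Pi.sub_apply, hv.eq_zero y hy, hw.eq_zero y hy, sub_zero]
  · exact (memLp_two_iff.mp ((memLp_two_iff.mpr ⟨hv.measurable.aestronglyMeasurable,
      hv.lintegral_sq_lt_top⟩).sub (memLp_two_iff.mpr ⟨hw.measurable.aestronglyMeasurable,
      hw.lintegral_sq_lt_top⟩))).2

theorem IsKernel.mono {s s' : ℝ} {w : Plane → ℝ} (hw : IsKernel s w) (h : s ≤ s') :
    IsKernel s' w :=
  ⟨hw.measurable, fun y hy => hw.eq_zero y (h.trans_lt hy), hw.lintegral_sq_lt_top⟩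

/-- The Cauchy–Schwarz inequality for a convolution, with the second factor localized to the ball that
the kernel can reach. -/
theorem IsKernel.sq_lintegral_le {s r : ℝ} {w U : Plane → ℝ} (hw : IsKernel s w)
    (hU : Measurable U) {x : Plane} (hx : ‖x‖ ≤ r) :
    (∫⁻ y, ‖w y * U (x - y)‖ₑ) ^ 2 ≤
      (∫⁻ y, ‖w y‖ₑ ^ 2) * ∫⁻ z in Metric.closedBall 0 (r + s), ‖U z‖ₑ ^ 2 := by
  set B := Metric.closedBall (0 : Plane) (r + s)
  have hB : MeasurableSet B := Metric.isClosed_closedBall.measurableSet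
  set V : Plane → ℝ≥0∞ := B.indicator fun z => ‖U z‖ₑ
  have hV : Measurable V := hU.enorm.indicator hB
  have h1 : ∀ y, ‖w y * U (x - y)‖ₑ = ‖w y‖ₑ * V (x - y) := by
    intro y
    rw [enorm_mul]
    by_cases hy : s < ‖y‖
    · simp [hw.eq_zero y hy]
    · have hmem : x - y ∈ B := by
        rw [mem_closedBall_zero_iff]
        linarith [norm_sub_le x y]
      rw [show V (x - y) = ‖U (x - y)‖ₑ from indicator_of_mem hmem _]
  have hw' : AEMeasurable fun y => ‖w y‖ₑ := hw.measurable.enorm.aemeasurable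
  simp_rw [h1]
  refine (lintegral_mul_sq_le hw' (by fun_prop)).trans (le_of_eq ?_)
  rw [lintegral_sub_left_eq_self (fun z => V z ^ 2) x, ← lintegral_indicator hB]
  congr 2 with z
  by_cases hz : z ∈ B <;> simp [V, hz]

theorem IsKernel.sq_enorm_conv_le {s r : ℝ} {w U : Plane → ℝ} (hw : IsKernel s w)
    (hU : Measurable U) {x : Plane} (hx : ‖x‖ ≤ r) :
    ‖conv w U x‖ₑ ^ 2 ≤
      (∫⁻ y, ‖w y‖ₑ ^ 2) * ∫⁻ z in Metric.closedBall 0 (r + s), ‖U z‖ₑ ^ 2 := by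
  refine le_trans ?_ (hw.sq_lintegral_le hU hx)
  gcongr
  exact enorm_integral_le_lintegral_enorm _

theorem IsKernel.integrable {s : ℝ} {w U : Plane → ℝ} (hw : IsKernel s w)
    (hU : LocSquareIntegrable U) (x : Plane) : Integrable fun y => w y * U (x - y) := by
  refine ⟨(hw.measurable.mul (hU.measurable.comp (by fun_prop))).aestronglyMeasurable, ?_⟩
  have h := (hw.sq_lintegral_le hU.measurable le_rfl).trans_lt
    (ENNReal.mul_lt_top hw.lintegral_sq_lt_top (hU.lintegral_sq_lt_top (‖x‖ + s)))
  rw [ENNReal.pow_lt_top_iff] at h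
  exact h.resolve_right two_ne_zero

theorem IsKernel.conv_sub_left {s : ℝ} {v w U : Plane → ℝ} (hv : IsKernel s v) (hw : IsKernel s w)
    (hU : LocSquareIntegrable U) (x : Plane) : conv (v - w) U x = conv v U x - conv w U x := by
  unfold conv
  rw [← integral_sub (hv.integrable hU x) (hw.integrable hU x)]
  simp only [Pi.sub_apply, sub_mul]

theorem LocSquareIntegrable.comp_add_const {U : Plane → ℝ} (hU : LocSquareIntegrable U)
    (h : Plane) : LocSquareIntegrable fun x => U (x + h) := by
  refine ⟨hU.measurable.comp (by fun_prop), fun r => ?_⟩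
  refine lt_of_le_of_lt ?_ (hU.lintegral_sq_lt_top (r + ‖h‖))
  rw [← lintegral_indicator Metric.isClosed_closedBall.measurableSet,
    ← lintegral_indicator Metric.isClosed_closedBall.measurableSet,
    ← lintegral_add_right_eq_self
      ((Metric.closedBall (0 : Plane) (r + ‖h‖)).indicator fun x => ‖U x‖ₑ ^ 2) h]
  refine lintegral_mono fun x => ?_
  by_cases hx : x ∈ Metric.closedBall (0 : Plane) r
  · have hx' : x + h ∈ Metric.closedBall (0 : Plane) (r + ‖h‖) := by
      rw [mem_closedBall_zero_iff] at hx ⊢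
      linarith [norm_add_le x h]
    rw [indicator_of_mem hx, indicator_of_mem hx']
  · rw [indicator_of_notMem hx]
    exact zero_le

/-- A translation of a convolution falls on the second factor, so that the translation bound for that
factor makes the convolution Lipschitz, with a constant that is linear in the norm of the kernel. -/
theorem IsKernel.sq_enorm_conv_add_sub_le {s r : ℝ} {w U : Plane → ℝ} (hw : IsKernel s w)
    (hU : LocSquareIntegrable U) {C : NNReal}
    (hC : ∀ᶠ h in 𝓝 (0 : Plane),
      ∫⁻ x in Metric.closedBall 0 (r + s), ‖U (x + h) - U x‖ₑ ^ 2 ≤ C * ‖h‖ₑ ^ 2)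
    {x : Plane} (hx : ‖x‖ ≤ r) :
    ∀ᶠ h in 𝓝 (0 : Plane),
      ‖conv w U (x + h) - conv w U x‖ₑ ^ 2 ≤ (∫⁻ y, ‖w y‖ₑ ^ 2) * (C * ‖h‖ₑ ^ 2) := by
  filter_upwards [hC] with h hh
  have h1 : conv w U (x + h) - conv w U x = conv w (fun z => U (z + h) - U z) x := by
    unfold conv
    rw [← integral_sub (hw.integrable hU _) (hw.integrable hU _)]
    congr 1 with y
    rw [mul_sub, add_sub_right_comm]
  rw [h1]
  refine (hw.sq_enorm_conv_le ?_ hx).trans (by gcongr)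
  exact (hU.comp_add_const h).measurable.sub hU.measurable

/-! ### Approximation by smooth kernels -/

theorem IsKernel.exists_smooth {s : ℝ} {w : Plane → ℝ} (hw : IsKernel s w) {ε : ℝ} (hε : 0 < ε) :
    ∃ g : Plane → ℝ, IsKernel (|s| + 2) g ∧ ContDiff ℝ ∞ g ∧ HasCompactSupport g ∧
      ∫⁻ y, ‖(g - w) y‖ₑ ^ 2 ≤ ENNReal.ofReal ε ^ 2 := by
  have hs := abs_nonneg s
  have hmem : MemLp w 2 := memLp_two_iff.mpr ⟨hw.measurable.aestronglyMeasurable,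
    hw.lintegral_sq_lt_top⟩
  obtain ⟨g, hgc, hgs, hg⟩ := hmem.exist_eLpNorm_sub_le (by simp) one_le_two hε
  -- a cutoff that is `1` on the support of `w`
  let χ : ContDiffBump (0 : Plane) := ⟨|s| + 1, |s| + 2, by linarith, by linarith⟩
  have hχs : ContDiff ℝ ∞ χ := χ.contDiff
  have hsm : ContDiff ℝ ∞ fun y => χ y * g y := hχs.mul hgs
  have hcs : HasCompactSupport fun y => χ y * g y := hgc.mul_left
  refine ⟨fun y => χ y * g y, ⟨hsm.continuous.measurable, fun y hy => ?_, ?_⟩, hsm, hcs, ?_⟩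
  · have : χ y = 0 := χ.zero_of_le_dist (by rw [dist_zero_right]; exact hy.le)
    rw [this, zero_mul]
  · exact (memLp_two_iff.mp (hsm.continuous.memLp_of_hasCompactSupport hcs)).2
  · calc ∫⁻ y, ‖χ y * g y - w y‖ₑ ^ 2 ≤ ∫⁻ y, ‖(w - g) y‖ₑ ^ 2 := by
          refine lintegral_mono fun y => ?_
          have h1 : χ y * g y - w y = χ y * (g y - w y) := by
            by_cases hy : s < ‖y‖
            · rw [hw.eq_zero y hy, sub_zero, sub_zero]
            · have : χ y = 1 := χ.one_of_mem_closedBall (by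
                rw [mem_closedBall_zero_iff]
                change ‖y‖ ≤ |s| + 1
                linarith [le_abs_self s])
              rw [this, one_mul, one_mul]
          rw [h1, enorm_mul, Pi.sub_apply, ← enorm_neg (w y - g y), neg_sub]
          gcongr
          refine mul_le_of_le_one_left' ?_
          rw [← ofReal_norm, ENNReal.ofReal_le_one, Real.norm_of_nonneg χ.nonneg]
          exact χ.le_one
      _ = eLpNorm (w - g) 2 volume ^ 2 := (eLpNorm_two_sq _).symm
      _ ≤ _ := by gcongr

/-- A sequence of smooth kernels with supports in a common ball that converges in `L²`. -/
theorem IsKernel.exists_seq_smooth {s : ℝ} {w : Plane → ℝ} (hw : IsKernel s w) :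
    ∃ (s' : ℝ) (g : ℕ → Plane → ℝ), IsKernel s' w ∧ (∀ n, IsKernel s' (g n)) ∧
      (∀ n, ContDiff ℝ ∞ (g n)) ∧ (∀ n, HasCompactSupport (g n)) ∧
      ∀ n : ℕ, ∫⁻ y, ‖(g n - w) y‖ₑ ^ 2 ≤ ENNReal.ofReal (1 / ((n : ℝ) + 1)) ^ 2 := by
  choose g h1 h2 h3 h4 using fun n : ℕ =>
    hw.exists_smooth (ε := 1 / ((n : ℝ) + 1)) (by positivity)
  exact ⟨|s| + 2, g, hw.mono (by linarith [le_abs_self s]), h1, h2, h3, h4⟩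

/-- Convergence of kernels in `L²` gives locally uniform convergence of the convolutions. -/
theorem tendstoUniformlyOn_conv {s : ℝ} {w U : Plane → ℝ} {g : ℕ → Plane → ℝ} (hw : IsKernel s w)
    (hg : ∀ n, IsKernel s (g n)) (hU : LocSquareIntegrable U)
    (hgw : ∀ n : ℕ, ∫⁻ y, ‖(g n - w) y‖ₑ ^ 2 ≤ ENNReal.ofReal (1 / ((n : ℝ) + 1)) ^ 2) (r : ℝ) :
    TendstoUniformlyOn (fun n => conv (g n) U) (conv w U) atTop (Metric.closedBall 0 r) := by
  set M := ∫⁻ z in Metric.closedBall 0 (r + s), ‖U z‖ₑ ^ 2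
  have hM : M ≠ ⊤ := (hU.lintegral_sq_lt_top _).ne
  have hbound : ∀ n : ℕ, ∀ x ∈ Metric.closedBall (0 : Plane) r,
      ‖conv (g n) U x - conv w U x‖ ≤ 1 / ((n : ℝ) + 1) * Real.sqrt M.toReal := by
    intro n x hx
    rw [mem_closedBall_zero_iff] at hx
    have h1 := ((hg n).sub hw).sq_enorm_conv_le hU.measurable hx
    rw [(hg n).conv_sub_left hw hU] at h1
    have h2 := h1.trans (mul_le_mul_left (hgw n) M)
    have h3 := ENNReal.toReal_mono (by finiteness) h2
    rw [ENNReal.toReal_mul, ENNReal.toReal_pow, ENNReal.toReal_pow, toReal_enorm,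
      ENNReal.toReal_ofReal (by positivity)] at h3
    refine abs_le_of_sq_le_sq' ?_ (by positivity) |>.2
    rw [mul_pow, Real.sq_sqrt ENNReal.toReal_nonneg]
    exact h3
  rw [Metric.tendstoUniformlyOn_iff]
  intro ε hε
  have hlim : Tendsto (fun n : ℕ => 1 / ((n : ℝ) + 1) * Real.sqrt M.toReal) atTop (𝓝 0) := by
    simpa using tendsto_one_div_add_atTop_nhds_zero_nat.mul_const (Real.sqrt M.toReal)
  filter_upwards [hlim.eventually_lt_const hε] with n hn x hx
  rw [dist_comm, dist_eq_norm]
  exact (hbound n x hx).trans_lt hn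

/-- The convolution of a square-integrable kernel and a locally square-integrable function is
continuous. -/
theorem IsKernel.continuous_conv {s : ℝ} {w U : Plane → ℝ} (hw : IsKernel s w)
    (hU : LocSquareIntegrable U) : Continuous (conv w U) := by
  obtain ⟨s', g, hw', hg, hgs, hgc, hgw⟩ := hw.exists_seq_smooth
  have hcont : ∀ n, Continuous (conv (g n) U) := fun n => by
    rw [conv_eq_convolution]
    exact (hgc n).continuous_convolution_left _ (hgs n).continuous hU.locallyIntegrable
  rw [continuous_iff_continuousAt]
  intro x
  refine ((tendstoUniformlyOn_conv hw' hg hU hgw (‖x‖ + 1)).continuousOn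
    (Frequently.of_forall fun n => (hcont n).continuousOn)).continuousAt ?_
  refine mem_of_superset (Metric.closedBall_mem_nhds x one_pos) fun y hy => ?_
  rw [mem_closedBall_zero_iff]
  rw [Metric.mem_closedBall, dist_eq_norm] at hy
  linarith [norm_sub_norm_le y x]

/-- If moreover `U` has an `L²` translation bound, the convolution is continuously differentiable: for
smooth kernels the derivative is bounded by the `L²` norm of the kernel, so the derivatives for
approximating smooth kernels converge locally uniformly. -/
theorem IsKernel.exists_hasFDerivAt_conv {s : ℝ} {w U : Plane → ℝ} (hw : IsKernel s w)
    (hU : LocSquareIntegrable U) (hUt : TranslationBound 2 U) :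
    ∃ G : Plane → Plane →L[ℝ] ℝ, Continuous G ∧ ∀ x, HasFDerivAt (conv w U) (G x) x := by
  obtain ⟨s', g, hw', hg, hgs, hgc, hgw⟩ := hw.exists_seq_smooth
  have hC1 : ∀ n, ContDiff ℝ 1 (conv (g n) U) := fun n => by
    rw [conv_eq_convolution]
    exact (hgc n).contDiff_convolution_left (n := 1) _ ((hgs n).of_le (by exact_mod_cast le_top))
      hU.locallyIntegrable
  have hder : ∀ n x, HasFDerivAt (conv (g n) U) (fderiv ℝ (conv (g n) U) x) x := fun n x =>
    ((hC1 n).differentiable one_ne_zero x).hasFDerivAt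
  have hdist : ∀ m n N : ℕ, N ≤ m → N ≤ n →
      ∫⁻ y, ‖(g m - g n) y‖ₑ ^ 2 ≤ ENNReal.ofReal (2 * (1 / ((N : ℝ) + 1))) ^ 2 := by
    intro m n N hm hn
    have hle : ∀ k : ℕ, N ≤ k → eLpNorm (g k - w) 2 volume ≤ ENNReal.ofReal (1 / ((N : ℝ) + 1)) := by
      intro k hk
      have h1 := hgw k
      rw [← eLpNorm_two_sq] at h1
      refine (ENNReal.pow_le_pow_left_iff two_ne_zero).mp h1 |>.trans ?_
      gcongr
    have hae : ∀ k, AEStronglyMeasurable (g k - w) volume := fun k =>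
      ((hg k).measurable.sub hw.measurable).aestronglyMeasurable
    have heq : g m - g n = (g m - w) - (g n - w) := by abel
    rw [← eLpNorm_two_sq, heq]
    gcongr
    refine (eLpNorm_sub_le (hae m) (hae n) one_le_two).trans ?_
    rw [two_mul, ENNReal.ofReal_add (by positivity) (by positivity)]
    exact add_le_add (hle m hm) (hle n hn)
  have hcauchy : ∀ r : ℝ, UniformCauchySeqOn (fun n => fderiv ℝ (conv (g n) U)) atTop
      (Metric.closedBall 0 r) := by
    intro r
    obtain ⟨C, hC⟩ := hUt (r + s')
    have hbound : ∀ m n N : ℕ, N ≤ m → N ≤ n → ∀ x ∈ Metric.closedBall (0 : Plane) r,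
        ‖fderiv ℝ (conv (g m) U) x - fderiv ℝ (conv (g n) U) x‖ ≤
          2 * (1 / ((N : ℝ) + 1)) * Real.sqrt C := by
      intro m n N hm hn x hx
      rw [mem_closedBall_zero_iff] at hx
      refine ((hder m x).sub (hder n x)).le_of_lip' (by positivity) ?_
      have h1 := ((hg m).sub (hg n)).sq_enorm_conv_add_sub_le hU hC hx
      have h2 : Tendsto (fun y => y - x) (𝓝 x) (𝓝 0) := by
        have : Continuous fun y : Plane => y - x := by fun_prop
        simpa using this.tendsto x
      filter_upwards [h2.eventually h1] with y hy
      rw [add_sub_cancel, (hg m).conv_sub_left (hg n) hU, (hg m).conv_sub_left (hg n) hU] at hy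
      have h3 := hy.trans (mul_le_mul_left (hdist m n N hm hn) _)
      have h4 := ENNReal.toReal_mono (by finiteness) h3
      rw [ENNReal.toReal_mul, ENNReal.toReal_mul, ENNReal.toReal_pow, ENNReal.toReal_pow,
        ENNReal.toReal_pow, toReal_enorm, toReal_enorm, ENNReal.toReal_ofReal (by positivity),
        ENNReal.coe_toReal] at h4
      refine abs_le_of_sq_le_sq' ?_ (by positivity) |>.2
      rw [mul_pow, mul_pow _ (Real.sqrt C), Real.sq_sqrt C.coe_nonneg, mul_assoc]
      exact h4
    rw [Metric.uniformCauchySeqOn_iff]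
    intro ε hε
    have hlim : Tendsto (fun n : ℕ => 2 * (1 / ((n : ℝ) + 1)) * Real.sqrt C) atTop (𝓝 0) := by
      simpa using (tendsto_one_div_add_atTop_nhds_zero_nat.const_mul 2).mul_const (Real.sqrt C)
    obtain ⟨N, hN⟩ := (hlim.eventually_lt_const hε).exists
    refine ⟨N, fun m hm n hn x hx => ?_⟩
    rw [dist_eq_norm]
    exact (hbound m n N hm hn x hx).trans_lt hN
  have hlim : ∀ x, ∃ L, Tendsto (fun n => fderiv ℝ (conv (g n) U) x) atTop (𝓝 L) := fun x =>
    cauchySeq_tendsto_of_complete ((hcauchy ‖x‖).cauchySeq (by simp))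
  choose G hG using hlim
  have hunif : ∀ r : ℝ, TendstoUniformlyOn (fun n => fderiv ℝ (conv (g n) U)) G atTop
      (Metric.closedBall 0 r) := fun r =>
    (hcauchy r).tendstoUniformlyOn_of_tendsto fun x _ => hG x
  refine ⟨G, continuous_iff_continuousAt.mpr fun x => ?_, fun x => ?_⟩
  · refine ((hunif (‖x‖ + 1)).continuousOn (Frequently.of_forall fun n =>
      ((hC1 n).continuous_fderiv one_ne_zero).continuousOn)).continuousAt ?_
    refine mem_of_superset (Metric.closedBall_mem_nhds x one_pos) fun y hy => ?_
    rw [mem_closedBall_zero_iff]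
    rw [Metric.mem_closedBall, dist_eq_norm] at hy
    linarith [norm_sub_norm_le y x]
  · refine hasFDerivAt_of_tendstoUniformlyOn (Metric.isOpen_ball (x := (0 : Plane)) (ε := ‖x‖ + 1))
      ((hunif (‖x‖ + 1)).mono Metric.ball_subset_closedBall) (fun n y _ => hder n y)
      (fun y hy => (tendstoUniformlyOn_conv hw' hg hU hgw (‖x‖ + 1)).tendsto_at
        (Metric.ball_subset_closedBall hy)) ?_
    rw [mem_ball_zero_iff]
    linarith

/-! ### Convolution of measures and of integrable functions with square-integrable kernels -/

/-- The inequality `‖w * m‖₂ ≤ m(ℝ²) ‖w‖₂` of Young for a measure `m` and a kernel `w`. -/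
theorem lintegral_sq_lintegral_le (m : Measure Plane) [SFinite m] {w : Plane → ℝ}
    (hw : Measurable w) :
    ∫⁻ x, (∫⁻ z, ‖w (x - z)‖ₑ ∂m) ^ 2 ≤ m univ ^ 2 * ∫⁻ y, ‖w y‖ₑ ^ 2 := by
  have hmeas : Measurable fun q : Plane × Plane => ‖w (q.1 - q.2)‖ₑ ^ 2 := by fun_prop
  calc ∫⁻ x, (∫⁻ z, ‖w (x - z)‖ₑ ∂m) ^ 2
      ≤ ∫⁻ x, m univ * ∫⁻ z, ‖w (x - z)‖ₑ ^ 2 ∂m := by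
        refine lintegral_mono fun x => ?_
        have h := lintegral_mul_sq_le (m := m) (f := fun _ => 1) (g := fun z => ‖w (x - z)‖ₑ)
          aemeasurable_const (by fun_prop)
        simpa using h
    _ = m univ * ∫⁻ z, (∫⁻ x, ‖w (x - z)‖ₑ ^ 2) ∂m := by
        rw [lintegral_const_mul _ hmeas.lintegral_prod_right']
        rw [lintegral_lintegral_swap (f := fun x z => ‖w (x - z)‖ₑ ^ 2) hmeas.aemeasurable]
    _ = m univ ^ 2 * ∫⁻ y, ‖w y‖ₑ ^ 2 := by
        have h : ∀ z, ∫⁻ x, ‖w (x - z)‖ₑ ^ 2 = ∫⁻ y, ‖w y‖ₑ ^ 2 := fun z =>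
          lintegral_sub_right_eq_self (fun y => ‖w y‖ₑ ^ 2) z
        simp_rw [h]
        rw [lintegral_const]
        ring

theorem IsKernel.ae_integrable_measure {s : ℝ} {w : Plane → ℝ} (hw : IsKernel s w)
    (m : Measure Plane) [IsFiniteMeasure m] : ∀ᵐ x, Integrable (fun z => w (x - z)) m := by
  have h1 : Measurable fun x => (∫⁻ z, ‖w (x - z)‖ₑ ∂m) ^ 2 := by
    have : Measurable fun q : Plane × Plane => ‖w (q.1 - q.2)‖ₑ :=
      (hw.measurable.comp (measurable_fst.sub measurable_snd)).enorm
    exact this.lintegral_prod_right'.pow_const 2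
  have h2 := (lintegral_sq_lintegral_le m hw.measurable).trans_lt
    (ENNReal.mul_lt_top (by finiteness) hw.lintegral_sq_lt_top)
  filter_upwards [ae_lt_top h1 h2.ne] with x hx
  rw [ENNReal.pow_lt_top_iff] at hx
  exact ⟨(hw.measurable.comp (by fun_prop)).aestronglyMeasurable, hx.resolve_right two_ne_zero⟩

/-- For almost every `x`, a change of the kernel on a null set is not seen by a given measure `m`, even
if `m` is singular. -/
theorem ae_ae_sub_eq {f g : Plane → ℝ} (hfg : f =ᵐ[volume] g) (m : Measure Plane) [SFinite m] :
    ∀ᵐ x, ∀ᵐ z ∂m, f (x - z) = g (x - z) := by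
  set N := toMeasurable volume {y | ¬ f y = g y}
  have hN : volume N = 0 := by rw [measure_toMeasurable]; exact hfg
  have hNm : MeasurableSet N := measurableSet_toMeasurable _ _
  have h1 : ∀ᵐ z ∂m, ∀ᵐ x, x - z ∉ N := Eventually.of_forall fun z =>
    (measurePreserving_sub_right volume z).quasiMeasurePreserving.ae (measure_eq_zero_iff_ae_notMem.mp hN)
  have h2 : MeasurableSet {q : Plane × Plane | q.2 - q.1 ∉ N} :=
    (measurable_snd.sub measurable_fst) hNm.compl
  filter_upwards [(Measure.ae_ae_comm (p := fun z x : Plane => x - z ∉ N) h2).mp h1] with x hx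
  filter_upwards [hx] with z hz
  by_contra hcon
  exact hz (subset_toMeasurable _ _ hcon)

theorem integral_smul_toSignedMeasure (m : Measure Plane) [IsFiniteMeasure m] (f : Plane → ℝ) :
    ∫ᵛ z, f z ∂•m.toSignedMeasure = ∫ z, f z ∂m := by
  rw [← VectorMeasure.integral_toSignedMeasure (μ := m)]
  congr 1
  ext
  simp

/-- The convolution with a signed measure `m₁ - m₂`, computed with a measurable representative of the
kernel. -/
theorem convMeasure_ae_eq {S : Set Plane} {s : ℝ} {w v : Plane → ℝ} (hv : IsKernel s v)
    (hwv : S.indicator w =ᵐ[volume] v) (m₁ m₂ : Measure Plane) [IsFiniteMeasure m₁]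
    [IsFiniteMeasure m₂] :
    convMeasure S (m₁.toSignedMeasure - m₂.toSignedMeasure) w =ᵐ[volume]
      fun x => ∫ z, v (x - z) ∂m₁ - ∫ z, v (x - z) ∂m₂ := by
  filter_upwards [ae_ae_sub_eq hwv m₁, ae_ae_sub_eq hwv m₂, hv.ae_integrable_measure m₁,
    hv.ae_integrable_measure m₂] with x h1 h2 h3 h4
  unfold convMeasure
  have h1' : (fun z => S.indicator w (x - z)) =ᵐ[m₁] fun z => v (x - z) := h1
  have h2' : (fun z => S.indicator w (x - z)) =ᵐ[m₂] fun z => v (x - z) := h2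
  rw [VectorMeasure.integral_sub_vectorMeasure, integral_smul_toSignedMeasure,
    integral_smul_toSignedMeasure, integral_congr_ae h1', integral_congr_ae h2']
  · rw [VectorMeasure.Integrable, Measure.variation_toSignedMeasure]
    exact h3.congr h1'.symm
  · rw [VectorMeasure.Integrable, Measure.variation_toSignedMeasure]
    exact h4.congr h2'.symm

/-- The convolution of a finite signed measure and a square-integrable kernel is square-integrable. -/
theorem exists_locSquareIntegrable_convMeasure {S : Set Plane} {s : ℝ} {w v : Plane → ℝ}
    (hv : IsKernel s v) (hwv : S.indicator w =ᵐ[volume] v) (ν : SignedMeasure Plane) :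
    ∃ F, LocSquareIntegrable F ∧ convMeasure S ν w =ᵐ[volume] F := by
  set m₁ := ν.toJordanDecomposition.posPart
  set m₂ := ν.toJordanDecomposition.negPart
  have hν : ν = m₁.toSignedMeasure - m₂.toSignedMeasure :=
    ν.toSignedMeasure_toJordanDecomposition.symm
  have hm : ∀ (m : Measure Plane) [IsFiniteMeasure m], Measurable fun x => ∫ z, v (x - z) ∂m := by
    intro m _
    have : Measurable fun q : Plane × Plane => v (q.1 - q.2) :=
      hv.measurable.comp (measurable_fst.sub measurable_snd)
    exact this.stronglyMeasurable.integral_prod_right'.measurable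
  have hL : ∀ (m : Measure Plane) [IsFiniteMeasure m], MemLp (fun x => ∫ z, v (x - z) ∂m) 2 := by
    intro m _
    refine memLp_two_iff.mpr ⟨(hm m).aestronglyMeasurable, ?_⟩
    refine lt_of_le_of_lt ?_ ((lintegral_sq_lintegral_le m hv.measurable).trans_lt
      (ENNReal.mul_lt_top (by finiteness) hv.lintegral_sq_lt_top))
    refine lintegral_mono fun x => ?_
    gcongr
    exact enorm_integral_le_lintegral_enorm _
  refine ⟨fun x => ∫ z, v (x - z) ∂m₁ - ∫ z, v (x - z) ∂m₂, ⟨(hm m₁).sub (hm m₂), fun r => ?_⟩, ?_⟩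
  · exact (setLIntegral_le_lintegral _ _).trans_lt (memLp_two_iff.mp ((hL m₁).sub (hL m₂))).2
  · rw [hν]
    exact convMeasure_ae_eq hv hwv m₁ m₂

/-- The convolution with a signed measure that has an integrable density is a convolution of
functions. -/
theorem convMeasure_withDensity_ae_eq {S : Set Plane} {s : ℝ} {w v : Plane → ℝ} (hv : IsKernel s v)
    (hwv : S.indicator w =ᵐ[volume] v) {V : Plane → ℝ} (hVm : Measurable V) (hV : Integrable V) :
    convMeasure S (volume.withDensityᵥ V) w =ᵐ[volume] conv v V := by
  have hp : Measurable fun x => ENNReal.ofReal (V x) := hVm.ennreal_ofReal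
  have hn : Measurable fun x => ENNReal.ofReal (-V x) := hVm.neg.ennreal_ofReal
  have i1 : IsFiniteMeasure (volume.withDensity fun x => ENNReal.ofReal (V x)) :=
    isFiniteMeasure_withDensity_ofReal hV.2
  have i2 : IsFiniteMeasure (volume.withDensity fun x => ENNReal.ofReal (-V x)) :=
    isFiniteMeasure_withDensity_ofReal hV.neg.2
  rw [withDensityᵥ_eq_withDensity_pos_part_sub_withDensity_neg_part hV]
  filter_upwards [convMeasure_ae_eq hv hwv (volume.withDensity fun x => ENNReal.ofReal (V x))
    (volume.withDensity fun x => ENNReal.ofReal (-V x)),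
    hv.ae_integrable_measure (volume.withDensity fun x => ENNReal.ofReal (V x)),
    hv.ae_integrable_measure (volume.withDensity fun x => ENNReal.ofReal (-V x))] with x hx h1 h2
  rw [integrable_withDensity_iff_integrable_smul' hp (by simp)] at h1
  rw [integrable_withDensity_iff_integrable_smul' hn (by simp)] at h2
  rw [hx, integral_withDensity_eq_integral_toReal_smul hp (by simp),
    integral_withDensity_eq_integral_toReal_smul hn (by simp),
    ← integral_sub h1 h2]
  unfold conv
  rw [← integral_sub_left_eq_self (fun y => v y * V (x - y)) volume x]
  congr 1 with z
  have hz : x - (x - z) = z := sub_sub_cancel x z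
  rw [hz, smul_eq_mul, smul_eq_mul, ← sub_mul, ENNReal.toReal_ofReal',
    ENNReal.toReal_ofReal', mul_comm]
  congr 1
  rcases le_total (V z) 0 with h | h
  · rw [max_eq_right h, max_eq_left (by linarith)]; ring
  · rw [max_eq_left h, max_eq_right (by linarith)]; ring

/-- Young's inequality for a convolution with an `L¹` function, localized to balls. -/
theorem IsKernel.setLIntegral_sq_le {s r : ℝ} {w V : Plane → ℝ} (hw : IsKernel s w)
    (hV : Measurable V) :
    ∫⁻ x in Metric.closedBall 0 r, (∫⁻ y, ‖w y * V (x - y)‖ₑ) ^ 2 ≤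
      (∫⁻ z in Metric.closedBall 0 (r + s), ‖V z‖ₑ) ^ 2 * ∫⁻ y, ‖w y‖ₑ ^ 2 := by
  set B := Metric.closedBall (0 : Plane) (r + s)
  have hB : MeasurableSet B := Metric.isClosed_closedBall.measurableSet
  set m := (volume.restrict B).withDensity fun z => ‖V z‖ₑ
  have hm : m univ = ∫⁻ z in B, ‖V z‖ₑ := by
    rw [withDensity_apply _ MeasurableSet.univ, Measure.restrict_univ]
  rw [← hm]
  refine le_trans ?_ ((setLIntegral_le_lintegral (Metric.closedBall 0 r) _).trans
    (lintegral_sq_lintegral_le m hw.measurable))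
  refine setLIntegral_mono' Metric.isClosed_closedBall.measurableSet fun x hx => ?_
  refine pow_le_pow_left' ?_ 2
  have hwx : Measurable fun z => ‖w (x - z)‖ₑ :=
    (hw.measurable.comp (measurable_const.sub measurable_id)).enorm
  rw [lintegral_withDensity_eq_lintegral_mul _ hV.enorm hwx, ← lintegral_indicator hB,
    ← lintegral_sub_left_eq_self (fun y => ‖w y * V (x - y)‖ₑ) x]
  refine lintegral_mono fun z => ?_
  have hxz : x - (x - z) = z := sub_sub_cancel x z
  rw [hxz]
  by_cases hz : z ∈ B
  · rw [indicator_of_mem hz, enorm_mul, mul_comm]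
    rfl
  · rw [mem_closedBall_zero_iff] at hx
    have : w (x - z) = 0 := hw.eq_zero _ (by
      rw [mem_closedBall_zero_iff] at hz
      have := norm_sub_norm_le z x
      rw [norm_sub_rev] at this
      linarith)
    simp [this]

theorem IsKernel.measurable_conv {s : ℝ} {w V : Plane → ℝ} (hw : IsKernel s w)
    (hV : Measurable V) : Measurable (conv w V) := by
  have : Measurable fun q : Plane × Plane => w q.2 * V (q.1 - q.2) :=
    (hw.measurable.comp measurable_snd).mul (hV.comp (measurable_fst.sub measurable_snd))
  exact this.stronglyMeasurable.integral_prod_right'.measurable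

section LocallyIntegrable

variable {s : ℝ} {w U : Plane → ℝ}

theorem IsKernel.ae_integrable (hw : IsKernel s w) (hUm : Measurable U)
    (hU : ∀ r : ℝ, ∫⁻ x in Metric.closedBall 0 r, ‖U x‖ₑ < ⊤) :
    ∀ᵐ x, Integrable fun y => w y * U (x - y) := by
  have hmeas : Measurable fun x => (∫⁻ y, ‖w y * U (x - y)‖ₑ) ^ 2 := by
    have : Measurable fun q : Plane × Plane => ‖w q.2 * U (q.1 - q.2)‖ₑ :=
      ((hw.measurable.comp measurable_snd).mul
        (hUm.comp (measurable_fst.sub measurable_snd))).enorm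
    exact this.lintegral_prod_right'.pow_const 2
  have h : ∀ n : ℕ, ∀ᵐ x : Plane, x ∈ Metric.closedBall (0 : Plane) n →
      (∫⁻ y, ‖w y * U (x - y)‖ₑ) ^ 2 < ⊤ := by
    intro n
    rw [← ae_restrict_iff' Metric.isClosed_closedBall.measurableSet]
    refine ae_lt_top hmeas ((hw.setLIntegral_sq_le hUm).trans_lt ?_).ne
    exact ENNReal.mul_lt_top (ENNReal.pow_lt_top (hU _)) hw.lintegral_sq_lt_top
  filter_upwards [ae_all_iff.mpr h] with x hx
  obtain ⟨n, hn⟩ := exists_nat_ge ‖x‖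
  have h1 := hx n (by simpa using hn)
  rw [ENNReal.pow_lt_top_iff] at h1
  exact ⟨(hw.measurable.mul (hUm.comp (by fun_prop))).aestronglyMeasurable,
    h1.resolve_right two_ne_zero⟩

theorem IsKernel.locSquareIntegrable_conv (hw : IsKernel s w) (hUm : Measurable U)
    (hU : ∀ r : ℝ, ∫⁻ x in Metric.closedBall 0 r, ‖U x‖ₑ < ⊤) :
    LocSquareIntegrable (conv w U) := by
  refine ⟨hw.measurable_conv hUm, fun r => ?_⟩
  refine lt_of_le_of_lt ?_ ((hw.setLIntegral_sq_le (r := r) hUm).trans_lt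
    (ENNReal.mul_lt_top (ENNReal.pow_lt_top (hU _)) hw.lintegral_sq_lt_top))
  refine lintegral_mono fun x => ?_
  gcongr
  exact enorm_integral_le_lintegral_enorm _

/-- Convolution with an `L²` kernel improves an `L¹` translation bound to an `L²` translation bound. -/
theorem IsKernel.translationBound_conv (hw : IsKernel s w) (hUm : Measurable U)
    (hU : ∀ r : ℝ, ∫⁻ x in Metric.closedBall 0 r, ‖U x‖ₑ < ⊤) (hUt : TranslationBound 1 U) :
    TranslationBound 2 (conv w U) := by
  intro r
  obtain ⟨C, hC⟩ := hUt (r + s)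
  refine ⟨C ^ 2 * (∫⁻ y, ‖w y‖ₑ ^ 2).toNNReal, ?_⟩
  filter_upwards [hC] with h hh
  have hint := hw.ae_integrable hUm hU
  have hint' := (measurePreserving_add_right volume h).quasiMeasurePreserving.ae hint
  calc ∫⁻ x in Metric.closedBall 0 r, ‖conv w U (x + h) - conv w U x‖ₑ ^ 2
      ≤ ∫⁻ x in Metric.closedBall 0 r,
          (∫⁻ y, ‖w y * (fun z => U (z + h) - U z) (x - y)‖ₑ) ^ 2 := by
        refine lintegral_mono_ae (ae_restrict_of_ae ?_)
        filter_upwards [hint, hint'] with x h1 h2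
        have h3 : conv w U (x + h) - conv w U x = ∫ y, w y * (U (x - y + h) - U (x - y)) := by
          unfold conv
          rw [← integral_sub h2 h1]
          congr 1 with y
          rw [mul_sub, add_sub_right_comm]
        rw [h3]
        gcongr
        exact enorm_integral_le_lintegral_enorm _
    _ ≤ (∫⁻ z in Metric.closedBall 0 (r + s), ‖U (z + h) - U z‖ₑ) ^ 2 * ∫⁻ y, ‖w y‖ₑ ^ 2 :=
        hw.setLIntegral_sq_le ((hUm.comp (by fun_prop)).sub hUm)
    _ ≤ (C * ‖h‖ₑ) ^ 2 * ∫⁻ y, ‖w y‖ₑ ^ 2 := by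
        gcongr
        simpa using hh
    _ = _ := by
        push_cast
        rw [ENNReal.coe_toNNReal hw.lintegral_sq_lt_top.ne]
        ring

end LocallyIntegrable

/-! ### Translation bounds for functions of bounded variation -/

theorem isFiniteMeasure_variation (ν : SignedMeasure Plane) : IsFiniteMeasure ν.variation := by
  rw [← SignedMeasure.totalVariation_eq_variation]
  infer_instance

/-- The mollification of `u`, extended by zero from `Ω`, by the normalized bump function `φ`. -/
noncomputable def mollify (φ : ContDiffBump (0 : Plane)) (Ω : Set Plane) (u : Plane → ℝ) :
    Plane → ℝ :=
  convolution (φ.normed volume) (Ω.indicator u) (ContinuousLinearMap.lsmul ℝ ℝ) volume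

section Mollify

variable {Ω : Set Plane} {u : Plane → ℝ} (φ : ContDiffBump (0 : Plane))

theorem contDiff_mollify (hΩ : MeasurableSet Ω) (hu : IntegrableOn u Ω) :
    ContDiff ℝ 1 (mollify φ Ω u) :=
  (φ.hasCompactSupport_normed (μ := volume)).contDiff_convolution_left (n := 1) _
    φ.contDiff_normed (hu.integrable_indicator hΩ).locallyIntegrable

theorem fderiv_mollify (hΩ : MeasurableSet Ω) (hu : IntegrableOn u Ω) (x e : Plane) :
    fderiv ℝ (mollify φ Ω u) x e =
      ∫ y in Ω, u y * fderiv ℝ (φ.normed volume) (x - y) e := by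
  have hint := (hu.integrable_indicator hΩ).locallyIntegrable
  have hcs : HasCompactSupport (φ.normed (volume : Measure Plane)) := φ.hasCompactSupport_normed
  have hc1 : ContDiff ℝ 1 (φ.normed (volume : Measure Plane)) := φ.contDiff_normed
  have h1 := hcs.hasFDerivAt_convolution_left (ContinuousLinearMap.lsmul ℝ ℝ) hc1 hint x
  have h2 : ConvolutionExistsAt (fderiv ℝ (φ.normed (volume : Measure Plane))) (Ω.indicator u) x
      (ContinuousLinearMap.precompL Plane (ContinuousLinearMap.lsmul ℝ ℝ)) volume :=
    (hcs.fderiv (𝕜 := ℝ)).convolutionExists_left _ (hc1.continuous_fderiv one_ne_zero) hint x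
  unfold mollify
  rw [h1.fderiv, convolution, ContinuousLinearMap.integral_apply h2,
    ← integral_sub_left_eq_self _ volume x, ← integral_indicator hΩ]
  congr 1 with y
  have hy : x - (x - y) = y := sub_sub_cancel x y
  rw [hy]
  simp only [ContinuousLinearMap.precompL_apply, ContinuousLinearMap.lsmul_apply, smul_eq_mul]
  by_cases h : y ∈ Ω
  · rw [indicator_of_mem h, indicator_of_mem h, mul_comm]
  · rw [indicator_of_notMem h, indicator_of_notMem h, mul_zero]

/-- The derivative of a mollification is the mollified distributional derivative, at points whose
distance to the boundary exceeds the radius of the mollifier. -/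
theorem fderiv_mollify_eq_integral (hΩ : MeasurableSet Ω) (hu : IntegrableOn u Ω) {e : Plane}
    {ν : SignedMeasure Plane} (hν : HasDistribDeriv Ω u e ν) {x : Plane}
    (hx : Metric.closedBall x φ.rOut ⊆ Ω) :
    fderiv ℝ (mollify φ Ω u) x e = ∫ᵛ y, φ.normed volume (x - y) ∂•ν := by
  set ψ : Plane → ℝ := fun y => φ.normed volume (x - y)
  have hψ : ContDiff ℝ ∞ ψ := φ.contDiff_normed.comp (contDiff_const.sub contDiff_id)
  have hsub : tsupport ψ ⊆ Metric.closedBall x φ.rOut := by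
    refine closure_minimal (fun y hy => ?_) Metric.isClosed_closedBall
    have h1 : x - y ∈ Function.support (φ.normed (volume : Measure Plane)) := hy
    rw [φ.support_normed_eq, mem_ball_zero_iff] at h1
    rw [Metric.mem_closedBall, dist_comm, dist_eq_norm]
    exact h1.le
  have hcs : HasCompactSupport ψ :=
    (isCompact_closedBall x φ.rOut).of_isClosed_subset (isClosed_tsupport _) hsub
  have h := hν ψ hψ hcs (hsub.trans hx)
  have hder : ∀ y, fderiv ℝ ψ y e = -fderiv ℝ (φ.normed volume) (x - y) e := by
    intro y
    have hd : DifferentiableAt ℝ (φ.normed (volume : Measure Plane)) (x - y) :=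
      (φ.contDiff_normed (n := 1)).differentiable one_ne_zero _
    have h1 : HasFDerivAt (fun y => x - y) (-ContinuousLinearMap.id ℝ Plane) y :=
      (hasFDerivAt_id y).const_sub x
    have h2 : HasFDerivAt ψ _ y := hd.hasFDerivAt.comp y h1
    rw [h2.fderiv]
    simp
  rw [fderiv_mollify φ hΩ hu, ← neg_neg (∫ᵛ y, ψ y ∂•ν), ← h, ← integral_neg]
  congr 1 with y
  rw [hder, mul_neg, neg_neg]

theorem enorm_fderiv_mollify_le (hΩ : MeasurableSet Ω) (hu : IntegrableOn u Ω)
    {ν₁ ν₂ : SignedMeasure Plane} (h₁ : HasDistribDeriv Ω u (1, 0) ν₁)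
    (h₂ : HasDistribDeriv Ω u (0, 1) ν₂) {x : Plane} (hx : Metric.closedBall x φ.rOut ⊆ Ω)
    (k : Plane) :
    ‖fderiv ℝ (mollify φ Ω u) x k‖ₑ ≤
      ‖k‖ₑ * ∫⁻ y, ‖φ.normed volume (x - y)‖ₑ ∂(ν₁.variation + ν₂.variation) := by
  have key : ∀ (e : Plane) (ν : SignedMeasure Plane), HasDistribDeriv Ω u e ν →
      ‖fderiv ℝ (mollify φ Ω u) x e‖ₑ ≤ ∫⁻ y, ‖φ.normed volume (x - y)‖ₑ ∂ν.variation := by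
    intro e ν hν
    rw [fderiv_mollify_eq_integral φ hΩ hu hν hx]
    refine VectorMeasure.enorm_integral_le_lintegral_enorm.trans (mul_le_of_le_one_left' ?_)
    rw [← ofReal_norm, ENNReal.ofReal_le_one]
    exact ContinuousLinearMap.opNorm_lsmul_le
  have hk : k = k.1 • ((1, 0) : Plane) + k.2 • ((0, 1) : Plane) := by
    ext <;> simp
  have h3 : fderiv ℝ (mollify φ Ω u) x k = k.1 * fderiv ℝ (mollify φ Ω u) x (1, 0) +
      k.2 * fderiv ℝ (mollify φ Ω u) x (0, 1) := by
    conv_lhs => rw [hk]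
    rw [map_add, map_smul, map_smul, smul_eq_mul, smul_eq_mul]
  have hk1 : ‖k.1‖ₑ ≤ ‖k‖ₑ := by
    rw [← ofReal_norm, ← ofReal_norm]
    exact ENNReal.ofReal_le_ofReal (norm_fst_le k)
  have hk2 : ‖k.2‖ₑ ≤ ‖k‖ₑ := by
    rw [← ofReal_norm, ← ofReal_norm]
    exact ENNReal.ofReal_le_ofReal (norm_snd_le k)
  rw [h3, lintegral_add_measure, mul_add]
  refine (enorm_add_le _ _).trans ?_
  rw [enorm_mul, enorm_mul]
  gcongr
  · exact key _ _ h₁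
  · exact key _ _ h₂

theorem lintegral_enorm_normed : ∫⁻ x, ‖φ.normed (volume : Measure Plane) x‖ₑ = 1 := by
  have h := ofReal_integral_eq_lintegral_ofReal (φ.integrable_normed (μ := volume))
    (Eventually.of_forall fun x => φ.nonneg_normed x)
  rw [φ.integral_normed, ENNReal.ofReal_one] at h
  rw [h]
  refine lintegral_congr fun x => ?_
  rw [← ofReal_norm, Real.norm_of_nonneg (φ.nonneg_normed x)]

/-- The translation bound for mollifications, where both ends of the translation are at a distance from
the boundary that exceeds the radius of the mollifier: integrate the derivative along the segments
from `x` to `x + k`, and use that the derivative has mass at most that of the distributional derivative. -/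
theorem lintegral_mollify_sub_le (hΩ : MeasurableSet Ω) (hΩc : Convex ℝ Ω)
    (hu : IntegrableOn u Ω) {ν₁ ν₂ : SignedMeasure Plane} (h₁ : HasDistribDeriv Ω u (1, 0) ν₁)
    (h₂ : HasDistribDeriv Ω u (0, 1) ν₂) (k : Plane) {A : Set Plane}
    (hA : ∀ x ∈ A, Metric.closedBall x φ.rOut ⊆ Ω)
    (hA' : ∀ x ∈ A, Metric.closedBall (x + k) φ.rOut ⊆ Ω) :
    ∫⁻ x, A.indicator (fun x => ‖mollify φ Ω u (x + k) - mollify φ Ω u x‖ₑ) x ≤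
      ‖k‖ₑ * (ν₁.variation + ν₂.variation) univ := by
  have := isFiniteMeasure_variation ν₁
  have := isFiniteMeasure_variation ν₂
  set m := ν₁.variation + ν₂.variation
  set Ψ : Plane → ℝ≥0∞ := fun x => ∫⁻ y, ‖φ.normed volume (x - y)‖ₑ ∂m
  have hρ : Continuous (φ.normed (volume : Measure Plane)) := φ.continuous_normed
  have hρm : Measurable fun q : Plane × Plane => ‖φ.normed volume (q.1 - q.2)‖ₑ :=
    (hρ.comp (continuous_fst.sub continuous_snd)).measurable.enorm
  have hΨ : Measurable Ψ := hρm.lintegral_prod_right'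
  have hΨint : ∫⁻ x, Ψ x = m univ := by
    rw [lintegral_lintegral_swap (f := fun x y => ‖φ.normed volume (x - y)‖ₑ) hρm.aemeasurable]
    have h : ∀ y, ∫⁻ x, ‖φ.normed (volume : Measure Plane) (x - y)‖ₑ = 1 := fun y =>
      (lintegral_sub_right_eq_self (fun x => ‖φ.normed (volume : Measure Plane) x‖ₑ) y).trans
        (lintegral_enorm_normed φ)
    simp_rw [h, lintegral_one]
  have hC1 := contDiff_mollify φ hΩ hu
  have hpt : ∀ x, A.indicator (fun x => ‖mollify φ Ω u (x + k) - mollify φ Ω u x‖ₑ) x ≤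
      ∫⁻ s in Ioc (0 : ℝ) 1, ‖k‖ₑ * Ψ (x + s • k) := by
    intro x
    by_cases hx : x ∈ A
    swap
    · rw [indicator_of_notMem hx]
      exact zero_le
    rw [indicator_of_mem hx]
    have hline : ∀ s : ℝ, HasDerivAt (fun s : ℝ => x + s • k) k s := fun s => by
      simpa using ((hasDerivAt_id s).smul_const k).const_add x
    have hder : ∀ s : ℝ, HasDerivAt (fun s : ℝ => mollify φ Ω u (x + s • k))
        (fderiv ℝ (mollify φ Ω u) (x + s • k) k) s := fun s =>
      (hC1.differentiable one_ne_zero _).hasFDerivAt.comp_hasDerivAt s (hline s)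
    have hcont : Continuous fun s : ℝ => fderiv ℝ (mollify φ Ω u) (x + s • k) k :=
      ((hC1.continuous_fderiv one_ne_zero).comp (by fun_prop)).clm_apply continuous_const
    have hftc := intervalIntegral.integral_eq_sub_of_hasDerivAt (a := 0) (b := 1)
      (fun s _ => hder s) (hcont.intervalIntegrable 0 1)
    rw [one_smul, zero_smul, add_zero] at hftc
    rw [← hftc, intervalIntegral.integral_of_le zero_le_one]
    refine (enorm_integral_le_lintegral_enorm _).trans ?_
    refine setLIntegral_mono' measurableSet_Ioc fun s hs => ?_
    refine enorm_fderiv_mollify_le φ hΩ hu h₁ h₂ (fun z hz => ?_) k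
    -- `z` lies on the segment from `z - s • k`, near `x`, to `z - s • k + k`, near `x + k`
    have hz1 : z - s • k ∈ Ω := hA x hx (by
      rw [Metric.mem_closedBall, dist_eq_norm] at hz ⊢
      rwa [sub_sub, add_comm (s • k) x])
    have hz2 : z - s • k + k ∈ Ω := hA' x hx (by
      rw [Metric.mem_closedBall, dist_eq_norm] at hz ⊢
      rwa [add_sub_add_right_eq_sub, sub_sub, add_comm (s • k) x])
    have hz3 := hΩc hz1 hz2 (sub_nonneg.mpr hs.2) hs.1.le (sub_add_cancel 1 s)
    have hz4 : (1 - s) • (z - s • k) + s • (z - s • k + k) = z := by module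
    rwa [hz4] at hz3
  have hΨ2 : Measurable fun q : Plane × ℝ => ‖k‖ₑ * Ψ (q.1 + q.2 • k) := by
    have : Measurable fun q : Plane × ℝ => q.1 + q.2 • k := by fun_prop
    exact (hΨ.comp this).const_mul _
  calc ∫⁻ x, A.indicator (fun x => ‖mollify φ Ω u (x + k) - mollify φ Ω u x‖ₑ) x
      ≤ ∫⁻ x, ∫⁻ s in Ioc (0 : ℝ) 1, ‖k‖ₑ * Ψ (x + s • k) := lintegral_mono hpt
    _ = ∫⁻ s in Ioc (0 : ℝ) 1, ∫⁻ x, ‖k‖ₑ * Ψ (x + s • k) :=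
        lintegral_lintegral_swap (f := fun (x : Plane) (s : ℝ) => ‖k‖ₑ * Ψ (x + s • k))
          hΨ2.aemeasurable
    _ = ∫⁻ s in Ioc (0 : ℝ) 1, ‖k‖ₑ * m univ := by
        refine lintegral_congr fun s => ?_
        rw [lintegral_const_mul' _ _ enorm_ne_top, lintegral_add_right_eq_self Ψ, hΨint]
    _ = ‖k‖ₑ * m univ := by simp

end Mollify

/-- A function of bounded variation on a convex open set is Lipschitz in `L¹` with respect to
translations. -/
theorem lintegral_sub_le_of_hasDistribDeriv {Ω : Set Plane} {u : Plane → ℝ} (hΩ : IsOpen Ω)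
    (hΩc : Convex ℝ Ω) (hu : IntegrableOn u Ω) {ν₁ ν₂ : SignedMeasure Plane}
    (h₁ : HasDistribDeriv Ω u (1, 0) ν₁) (h₂ : HasDistribDeriv Ω u (0, 1) ν₂) (k : Plane) :
    ∫⁻ x in Ω ∩ {x | x + k ∈ Ω}, ‖u (x + k) - u x‖ₑ ≤
      ‖k‖ₑ * (ν₁.variation + ν₂.variation) univ := by
  have hΩm := hΩ.measurableSet
  let φ : ℕ → ContDiffBump (0 : Plane) := fun n =>
    ⟨1 / ((n : ℝ) + 1), 2 * (1 / ((n : ℝ) + 1)), by positivity, by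
      have : 0 < 1 / ((n : ℝ) + 1) := by positivity
      linarith⟩
  have hφ : Tendsto (fun n => (φ n).rOut) atTop (𝓝 0) := by
    simpa only [mul_zero] using (tendsto_one_div_add_atTop_nhds_zero_nat (𝕜 := ℝ)).const_mul 2
  have hconv : ∀ᵐ x, Tendsto (fun n => mollify (φ n) Ω u x) atTop (𝓝 (Ω.indicator u x)) :=
    ContDiffBump.ae_convolution_tendsto_right_of_locallyIntegrable hφ
      (Eventually.of_forall fun n => le_refl (2 * (φ n).rIn))
      (hu.integrable_indicator hΩm).locallyIntegrable
  have hconv' := (measurePreserving_add_right volume k).quasiMeasurePreserving.ae hconv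
  -- the points at distance more than the mollification radius from the complement of `Ω`
  set A : ℕ → Set Plane := fun n => {x | ENNReal.ofReal (φ n).rOut < Metric.infEDist x Ωᶜ} ∩
    {x | ENNReal.ofReal (φ n).rOut < Metric.infEDist (x + k) Ωᶜ}
  have hball : ∀ (x : Plane) (n : ℕ), ENNReal.ofReal (φ n).rOut < Metric.infEDist x Ωᶜ →
      Metric.closedBall x (φ n).rOut ⊆ Ω := by
    intro x n hx z hz
    by_contra hcon
    have h1 : Metric.infEDist x Ωᶜ ≤ edist x z := Metric.infEDist_le_edist_of_mem hcon
    rw [edist_dist, dist_comm] at h1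
    exact absurd hx (not_lt.mpr (h1.trans (ENNReal.ofReal_le_ofReal hz)))
  have hev : ∀ x ∈ Ω, ∀ᶠ n in atTop, ENNReal.ofReal (φ n).rOut < Metric.infEDist x Ωᶜ := by
    intro x hx
    have h1 : 0 < Metric.infEDist x Ωᶜ := by
      rw [pos_iff_ne_zero]
      intro h0
      rw [← Metric.mem_iff_infEDist_zero_of_closed hΩ.isClosed_compl] at h0
      exact h0 hx
    have h2 : Tendsto (fun n => ENNReal.ofReal (φ n).rOut) atTop (𝓝 0) := by
      simpa using ENNReal.tendsto_ofReal hφ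
    exact h2.eventually_lt_const h1
  have hAm : ∀ n, MeasurableSet (A n) := fun n =>
    (measurableSet_lt measurable_const measurable_infEDist).inter
      (measurableSet_lt measurable_const (measurable_infEDist.comp (by fun_prop)))
  set f : ℕ → Plane → ℝ≥0∞ := fun n => (A n).indicator fun x =>
    ‖mollify (φ n) Ω u (x + k) - mollify (φ n) Ω u x‖ₑ
  have hfm : ∀ n, Measurable (f n) := fun n => by
    have h1 := (contDiff_mollify (φ n) hΩm hu).continuous
    have h2 : Continuous fun x => mollify (φ n) Ω u (x + k) := h1.comp (by fun_prop)
    exact (h2.sub h1).measurable.enorm.indicator (hAm n)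
  have hbound : ∀ n, ∫⁻ x, f n x ≤ ‖k‖ₑ * (ν₁.variation + ν₂.variation) univ := fun n =>
    lintegral_mollify_sub_le (φ n) hΩm hΩc hu h₁ h₂ k (fun x hx => hball x n hx.1)
      (fun x hx => hball (x + k) n hx.2)
  have hEm : MeasurableSet (Ω ∩ {x | x + k ∈ Ω}) :=
    hΩm.inter ((measurable_id.add_const k) hΩm)
  calc ∫⁻ x in Ω ∩ {x | x + k ∈ Ω}, ‖u (x + k) - u x‖ₑ
      ≤ ∫⁻ x, liminf (fun n => f n x) atTop := by
        rw [← lintegral_indicator hEm]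
        refine lintegral_mono_ae ?_
        filter_upwards [hconv, hconv'] with x hx hx'
        by_cases hxE : x ∈ Ω ∩ {x | x + k ∈ Ω}
        swap
        · rw [indicator_of_notMem hxE]
          exact zero_le
        rw [indicator_of_mem hxE]
        obtain ⟨h1, h2⟩ := hxE
        rw [indicator_of_mem h1] at hx
        rw [indicator_of_mem (show x + k ∈ Ω from h2)] at hx'
        have h3 : Tendsto (fun n => f n x) atTop (𝓝 ‖u (x + k) - u x‖ₑ) := by
          refine ((hx'.sub hx).enorm).congr' ?_
          filter_upwards [hev x h1, hev (x + k) h2] with n hn1 hn2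
          exact (indicator_of_mem (show x ∈ A n from ⟨hn1, hn2⟩) fun x =>
            ‖mollify (φ n) Ω u (x + k) - mollify (φ n) Ω u x‖ₑ).symm
        exact h3.liminf_eq.ge
    _ ≤ liminf (fun n => ∫⁻ x, f n x) atTop := lintegral_liminf_le hfm
    _ ≤ _ := liminf_le_of_frequently_le' (Frequently.of_forall hbound)

/-! ### The layers of the network -/

theorem LocSquareIntegrable.comp_lipschitz {F : Plane → ℝ} (hF : LocSquareIntegrable F)
    {σ : ℝ → ℝ} {K : NNReal} (hσ : LipschitzWith K σ) : LocSquareIntegrable fun x => σ (F x) := by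
  refine ⟨hσ.continuous.measurable.comp hF.measurable, fun r => ?_⟩
  calc ∫⁻ x in Metric.closedBall 0 r, ‖σ (F x)‖ₑ ^ 2
      ≤ ∫⁻ x in Metric.closedBall 0 r, 2 ^ 2 * (K ^ 2 * ‖F x‖ₑ ^ 2 + ‖σ 0‖ₑ ^ 2) := by
        refine lintegral_mono fun x => ?_
        have h1 := enorm_sub_pow_le 2 (σ (F x)) 0 (σ 0)
        rw [sub_zero, zero_sub, enorm_neg] at h1
        refine h1.trans ?_
        rw [← mul_pow]
        gcongr
        have h2 := hσ (F x) 0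
        rwa [edist_eq_enorm_sub, edist_eq_enorm_sub, sub_zero] at h2
    _ = 2 ^ 2 * (K ^ 2 * (∫⁻ x in Metric.closedBall 0 r, ‖F x‖ₑ ^ 2) +
          ‖σ 0‖ₑ ^ 2 * volume (Metric.closedBall (0 : Plane) r)) := by
        rw [lintegral_const_mul' _ _ (by simp), lintegral_add_right _ measurable_const,
          lintegral_const_mul' _ _ (by simp), setLIntegral_const]
    _ < ⊤ := by
        have h1 := hF.lintegral_sq_lt_top r
        have h2 : volume (Metric.closedBall (0 : Plane) r) < ⊤ :=
          (isCompact_closedBall (0 : Plane) r).measure_lt_top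
        finiteness

theorem LocSquareIntegrable.comp_fold {F : Plane → ℝ} (hF : LocSquareIntegrable F) (R : Rect) :
    LocSquareIntegrable fun x => F (R.fold x) := by
  refine ⟨hF.measurable.comp R.continuous_fold.measurable, fun r => ?_⟩
  obtain ⟨N, hN⟩ := R.exists_lintegral_fold_le
    (Metric.isBounded_closedBall (x := (0 : Plane)) (r := r))
  obtain ⟨ρ, hρ⟩ := R.isBounded_dom.subset_closedBall 0
  exact (hN fun x => ‖F x‖ₑ ^ 2).trans_lt (ENNReal.mul_lt_top (by simp)
    ((lintegral_mono_set hρ).trans_lt (hF.lintegral_sq_lt_top ρ)))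

/-- Continuously differentiable functions have the `L²` translation bound. -/
theorem TranslationBound.of_hasFDerivAt {F : Plane → ℝ} {G : Plane → Plane →L[ℝ] ℝ}
    (hG : Continuous G) (hF : ∀ x, HasFDerivAt F (G x) x) : TranslationBound 2 F := by
  intro r
  obtain ⟨C, hC⟩ := (isCompact_closedBall (0 : Plane) (r + 1)).bddAbove_image
    (f := fun x => ‖G x‖) (by fun_prop)
  have hvol : volume (Metric.closedBall (0 : Plane) r) ≠ ⊤ :=
    (isCompact_closedBall (0 : Plane) r).measure_lt_top.ne
  refine ⟨Real.toNNReal C ^ 2 * (volume (Metric.closedBall (0 : Plane) r)).toNNReal, ?_⟩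
  filter_upwards [Metric.closedBall_mem_nhds (0 : Plane) one_pos] with h hh
  rw [mem_closedBall_zero_iff] at hh
  calc ∫⁻ x in Metric.closedBall 0 r, ‖F (x + h) - F x‖ₑ ^ 2
      ≤ ∫⁻ x in Metric.closedBall (0 : Plane) r, (ENNReal.ofReal C * ‖h‖ₑ) ^ 2 := by
        refine setLIntegral_mono' Metric.isClosed_closedBall.measurableSet fun x hx => ?_
        rw [mem_closedBall_zero_iff] at hx
        have h1 := (convex_closedBall (0 : Plane) (r + 1)).norm_image_sub_le_of_norm_hasFDerivWithin_le
          (fun y _ => (hF y).hasFDerivWithinAt) (fun y hy => hC ⟨y, hy, rfl⟩)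
          (x := x) (y := x + h) (by rw [mem_closedBall_zero_iff]; linarith)
          (by rw [mem_closedBall_zero_iff]; linarith [norm_add_le x h])
        rw [add_sub_cancel_left] at h1
        gcongr
        rw [← ofReal_norm, ← ofReal_norm, ← ENNReal.ofReal_mul' (norm_nonneg h)]
        exact ENNReal.ofReal_le_ofReal h1
    _ = _ := by
        rw [setLIntegral_const]
        push_cast
        rw [ENNReal.coe_toNNReal hvol, ENNReal.ofReal]
        ring

/-- A square-integrable function on `S` has a measurable representative that vanishes outside `S`. -/
theorem exists_isKernel (S : Rect) {w : Plane → ℝ} (hw : MemLp w 2 (volume.restrict S.dom)) :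
    ∃ (s : ℝ) (v : Plane → ℝ), IsKernel s v ∧ S.dom.indicator w =ᵐ[volume] v ∧
      ∀ y ∉ S.dom, v y = 0 := by
  obtain ⟨s, hs⟩ := S.isBounded_dom.subset_closedBall 0
  have hS := S.measurableSet_dom
  have hae : S.dom.indicator w =ᵐ[volume] S.dom.indicator (hw.1.mk w) :=
    (ae_eq_restrict_iff_indicator_ae_eq hS).mp hw.1.ae_eq_mk
  refine ⟨s, S.dom.indicator (hw.1.mk w),
    ⟨hw.1.stronglyMeasurable_mk.measurable.indicator hS, fun y hy => ?_, ?_⟩, hae, fun y hy => ?_⟩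
  · refine indicator_of_notMem (fun h => ?_) _
    have := hs h
    rw [mem_closedBall_zero_iff] at this
    linarith
  · have h1 : MemLp (S.dom.indicator w) 2 volume := (memLp_indicator_iff_restrict hS).mpr hw
    exact (memLp_two_iff.mp (h1.ae_eq hae)).2
  · exact indicator_of_notMem hy _

/-- On the output domain `T`, the valid convolution with padding is the convolution over the plane of
the extended kernel and the function extended by reflection to the plane. -/
theorem convFun_reflectFun_eq (R S T : Rect) {f F w v : Plane → ℝ}
    (hf : f =ᵐ[volume.restrict R.dom] F) (hwv : S.dom.indicator w =ᵐ[volume] v)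
    (hv : ∀ y ∉ S.dom, v y = 0) {x : Plane} (hx : x ∈ T.dom) :
    convFun S.dom (reflectFun R (T.dom - S.dom) f) w x = conv v (fun z => F (R.fold z)) x := by
  unfold convFun conv
  rw [← integral_indicator S.measurableSet_dom]
  have h1 : ∀ᵐ y, f (R.fold (x - y)) = F (R.fold (x - y)) :=
    (quasiMeasurePreserving_sub_left_of_right_invariant volume x).ae (R.ae_fold hf)
  refine integral_congr_ae ?_
  filter_upwards [h1, hwv] with y hy1 hy2
  by_cases hy : y ∈ S.dom
  · rw [indicator_of_mem hy] at hy2 ⊢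
    rw [hy2, reflectFun, indicator_of_mem (sub_mem_sub hx hy), hy1]
  · rw [indicator_of_notMem hy, hv y hy, zero_mul]

section Network

variable {L : ℕ} {Ω S : ℕ → Rect} {σ : ℝ → ℝ} {K : NNReal} {w : ℕ → Plane → ℝ} {b : ℕ → ℝ}
  {μ : SignedMeasure Plane}

/-- From the second convolution on, the pre-activation is a convolution over the plane. -/
theorem exists_preactivation_succ_eq (hw : ∀ l < L, MemLp (w l) 2 (volume.restrict (S l).dom))
    {l : ℕ} (hl : l + 1 < L) {F : Plane → ℝ}
    (hF : preactivation Ω S σ w b μ l =ᵐ[volume.restrict (Ω (l + 1)).dom] F) :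
    ∃ (s : ℝ) (v : Plane → ℝ), IsKernel s v ∧ ∀ x ∈ (Ω (l + 2)).dom,
      preactivation Ω S σ w b μ (l + 1) x =
        conv v (fun z => σ (F ((Ω (l + 1)).fold z))) x + b (l + 1) := by
  obtain ⟨s, v, hv, hwv, hv0⟩ := exists_isKernel (S (l + 1)) (hw (l + 1) hl)
  refine ⟨s, v, hv, fun x hx => ?_⟩
  have hσF : (fun z => σ (preactivation Ω S σ w b μ l z)) =ᵐ[volume.restrict (Ω (l + 1)).dom]
      fun z => σ (F z) := hF.fun_comp σ
  exact congrArg (· + b (l + 1))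
    (convFun_reflectFun_eq (Ω (l + 1)) (S (l + 1)) (Ω (l + 2)) hσF hwv hv0 hx)

theorem exists_locSquareIntegrable_preactivation
    (hw : ∀ l < L, MemLp (w l) 2 (volume.restrict (S l).dom)) (hσ : LipschitzWith K σ) :
    ∀ l < L, ∃ F, LocSquareIntegrable F ∧
      preactivation Ω S σ w b μ l =ᵐ[volume.restrict (Ω (l + 1)).dom] F := by
  intro l
  induction l with
  | zero =>
    intro h0
    obtain ⟨s, v, hv, hwv, -⟩ := exists_isKernel (S 0) (hw 0 h0)
    obtain ⟨F, hF, hFe⟩ := exists_locSquareIntegrable_convMeasure hv hwv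
      (reflectMeasure (Ω 0) (padded Ω S 0) μ)
    exact ⟨fun x => F x + b 0, hF.comp_lipschitz (isometry_add_right (b 0)).lipschitz,
      ae_restrict_of_ae (hFe.fun_comp (· + b 0))⟩
  | succ l ih =>
    intro hl
    obtain ⟨F, hF, hFe⟩ := ih (by lia)
    obtain ⟨s, v, hv, h⟩ := exists_preactivation_succ_eq hw hl hFe
    have hU := (hF.comp_lipschitz hσ).comp_fold (Ω (l + 1))
    exact ⟨_, .of_continuous ((hv.continuous_conv hU).add continuous_const),
      ae_restrict_of_forall_mem (Ω (l + 2)).measurableSet_dom h⟩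

theorem TranslationBound.comp_fold {F : Plane → ℝ} (hFm : Measurable F) (hF : TranslationBound 2 F)
    (R : Rect) : TranslationBound 2 fun x => F (R.fold x) :=
  (EnergyBound.of_translationBound R.measurableSet_dom R.isBounded_dom hFm hF).comp_fold
    two_ne_zero R hFm

/-- A function of bounded variation has a measurable representative, whose extension by reflection has
the `L¹` translation bound. -/
theorem MemBV.exists_translationBound_fold {R : Rect} {u : Plane → ℝ} (hu : MemBV R.dom u) :
    ∃ u' : Plane → ℝ, Measurable u' ∧ IntegrableOn u' R.dom ∧ u =ᵐ[volume.restrict R.dom] u' ∧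
      TranslationBound 1 fun x => u' (R.fold x) := by
  obtain ⟨hint, ⟨ν₁, hν₁⟩, ⟨ν₂, hν₂⟩⟩ := hu
  obtain ⟨u', hum, huu⟩ : ∃ u' : Plane → ℝ, Measurable u' ∧ u =ᵐ[volume.restrict R.dom] u' :=
    ⟨_, hint.1.stronglyMeasurable_mk.measurable, hint.1.ae_eq_mk⟩
  have hint' : IntegrableOn u' R.dom := Integrable.congr hint huu
  have hder : ∀ (e : Plane) (ν : SignedMeasure Plane), HasDistribDeriv R.dom u e ν →
      HasDistribDeriv R.dom u' e ν := by
    intro e ν h ψ h1 h2 h3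
    rw [← h ψ h1 h2 h3]
    refine integral_congr_ae ?_
    filter_upwards [huu] with x hx
    rw [hx]
  refine ⟨u', hum, hint', huu, EnergyBound.comp_fold one_ne_zero R hum ?_⟩
  have := isFiniteMeasure_variation ν₁
  have := isFiniteMeasure_variation ν₂
  refine .of_translation R.measurableSet_dom hum
    (C := ((ν₁.variation + ν₂.variation) univ).toNNReal) (Eventually.of_forall fun k => ?_)
  simp only [pow_one]
  rw [ENNReal.coe_toNNReal (measure_ne_top _ _), mul_comm]
  exact lintegral_sub_le_of_hasDistribDeriv R.isOpen_dom R.convex_dom hint' (hder _ _ hν₁)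
    (hder _ _ hν₂) k

/-- On the output domain `T`, the convolution of the padded measure with density `u` is the convolution
over the plane of the extended kernel and the function `u` extended by reflection to the plane. -/
theorem convMeasure_reflectMeasure_ae_eq (R S T : Rect) {u w v : Plane → ℝ} (hum : Measurable u)
    (hu : IntegrableOn u R.dom) {s : ℝ} (hv : IsKernel s v)
    (hwv : S.dom.indicator w =ᵐ[volume] v) (hv0 : ∀ y ∉ S.dom, v y = 0) :
    convMeasure S.dom (reflectMeasure R (T.dom - S.dom) ((volume.restrict R.dom).withDensityᵥ u)) w
      =ᵐ[volume.restrict T.dom] conv v fun x => u (R.fold x) := by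
  have hAb : Bornology.IsBounded (T.dom - S.dom) := T.isBounded_dom.sub S.isBounded_dom
  have hAm : MeasurableSet (T.dom - S.dom) := T.isOpen_dom.sub_right.measurableSet
  rw [reflectMeasure_withDensity R hum hu hAb hAm]
  have hV : Integrable (reflectFun R (T.dom - S.dom) u) :=
    (integrableOn_comp_fold R hum hu hAb).integrable_indicator hAm
  have hVm : Measurable (reflectFun R (T.dom - S.dom) u) :=
    (hum.comp R.continuous_fold.measurable).indicator hAm
  filter_upwards [ae_restrict_of_ae (convMeasure_withDensity_ae_eq hv hwv hVm hV),
    ae_restrict_mem T.measurableSet_dom] with x hx hxT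
  rw [hx]
  unfold conv
  refine integral_congr_ae (Eventually.of_forall fun y => ?_)
  by_cases hy : y ∈ S.dom
  · simp only [reflectFun, indicator_of_mem (sub_mem_sub hxT hy)]
  · simp only [hv0 y hy, zero_mul]

/-- The pre-activation of the first layer has the `L²` translation bound if the input is of bounded
variation. -/
theorem exists_preactivation_zero_of_memBV
    (hw0 : MemLp (w 0) 2 (volume.restrict (S 0).dom)) {u : Plane → ℝ} (hu : MemBV (Ω 0).dom u)
    (hμ : μ = (volume.restrict (Ω 0).dom).withDensityᵥ u) :
    ∃ F, LocSquareIntegrable F ∧ TranslationBound 2 F ∧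
      preactivation Ω S σ w b μ 0 =ᵐ[volume.restrict (Ω 1).dom] F := by
  obtain ⟨u', hum, hint, huu, hUt⟩ := hu.exists_translationBound_fold
  obtain ⟨s, v, hv, hwv, hv0⟩ := exists_isKernel (S 0) hw0
  have hUm : Measurable fun x => u' ((Ω 0).fold x) := hum.comp (Ω 0).continuous_fold.measurable
  have hUint : ∀ r : ℝ, ∫⁻ x in Metric.closedBall 0 r, ‖u' ((Ω 0).fold x)‖ₑ < ⊤ := fun r =>
    (integrableOn_comp_fold (Ω 0) hum hint Metric.isBounded_closedBall).2
  have hb : LipschitzWith 1 fun t : ℝ => t + b 0 := (isometry_add_right (b 0)).lipschitz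
  have hconv := convMeasure_reflectMeasure_ae_eq (Ω 0) (S 0) (Ω 1) hum hint hv hwv hv0
  rw [← WithDensityᵥEq.congr_ae huu, ← hμ] at hconv
  have hF := (hv.locSquareIntegrable_conv hUm hUint).comp_lipschitz hb
  have hFt := (hv.translationBound_conv hUm hUint hUt).comp_lipschitz hb
  exact ⟨_, hF, hFt, hconv.fun_comp (· + b 0)⟩

theorem exists_translationBound_preactivation
    (hw : ∀ l < L, MemLp (w l) 2 (volume.restrict (S l).dom)) (hσ : LipschitzWith K σ)
    {u : Plane → ℝ} (hu : MemBV (Ω 0).dom u)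
    (hμ : μ = (volume.restrict (Ω 0).dom).withDensityᵥ u) :
    ∀ l < L, ∃ F, LocSquareIntegrable F ∧ TranslationBound 2 F ∧
      preactivation Ω S σ w b μ l =ᵐ[volume.restrict (Ω (l + 1)).dom] F := by
  intro l
  induction l with
  | zero => exact fun h0 => exists_preactivation_zero_of_memBV (hw 0 h0) hu hμ
  | succ l ih =>
    intro hl
    obtain ⟨F, hF, hFt, hFe⟩ := ih (by lia)
    obtain ⟨s, v, hv, h⟩ := exists_preactivation_succ_eq hw hl hFe
    have hσF := hF.comp_lipschitz hσ
    have hU := hσF.comp_fold (Ω (l + 1))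
    obtain ⟨G, hG, hGd⟩ := hv.exists_hasFDerivAt_conv hU
      ((hFt.comp_lipschitz hσ).comp_fold hσF.measurable (Ω (l + 1)))
    exact ⟨_, .of_continuous ((hv.continuous_conv hU).add continuous_const),
      .of_hasFDerivAt hG fun x => (hGd x).add_const (b (l + 1)),
      ae_restrict_of_forall_mem (Ω (l + 2)).measurableSet_dom h⟩

end Network

end FsCNN

theorem theorem2p4 (L : ℕ) (hL : 2 ≤ L) (Ω S : ℕ → FsCNN.Rect)
    (hS : ∀ l < L, (0 : FsCNN.Plane) ∈ (S l).dom)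
    (σ : ℝ → ℝ) (hσ : ∃ K : NNReal, LipschitzWith K σ)
    (w : ℕ → FsCNN.Plane → ℝ) (hw : ∀ l < L, MemLp (w l) 2 (volume.restrict (S l).dom))
    (b : ℕ → ℝ)
    (μ : SignedMeasure FsCNN.Plane) (hμ : FsCNN.IsMeasureOn (closure (Ω 0).dom) μ) :
    FsCNN.MemC (Ω L).dom (FsCNN.fsCNN L Ω S σ w b μ) ∧
    ((∃ u : FsCNN.Plane → ℝ, FsCNN.MemBV (Ω 0).dom u ∧
        μ = (volume.restrict (Ω 0).dom).withDensityᵥ u) →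
      FsCNN.MemC1 (Ω L).dom (FsCNN.fsCNN L Ω S σ w b μ)) := by
  obtain ⟨K, hK⟩ := hσ
  obtain ⟨l, rfl⟩ : ∃ l, L = l + 2 := ⟨L - 2, by lia⟩
  constructor
  · obtain ⟨F, hF, hFe⟩ := FsCNN.exists_locSquareIntegrable_preactivation (Ω := Ω) (b := b) (μ := μ)
      hw hK l (by lia)
    obtain ⟨s, v, hv, h⟩ := FsCNN.exists_preactivation_succ_eq hw (by lia) hFe
    have hU := (hF.comp_lipschitz hK).comp_fold (Ω (l + 1))
    exact ⟨_, ((hv.continuous_conv hU).add continuous_const).continuousOn,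
      ae_restrict_of_forall_mem (Ω (l + 2)).measurableSet_dom h⟩
  · rintro ⟨u, hu, hμu⟩
    obtain ⟨F, hF, hFt, hFe⟩ := FsCNN.exists_translationBound_preactivation (b := b) hw hK hu hμu l
      (by lia)
    obtain ⟨s, v, hv, h⟩ := FsCNN.exists_preactivation_succ_eq hw (by lia) hFe
    have hσF := hF.comp_lipschitz hK
    have hU := hσF.comp_fold (Ω (l + 1))
    obtain ⟨G, hG, hGd⟩ := hv.exists_hasFDerivAt_conv hU
      ((hFt.comp_lipschitz hK).comp_fold hσF.measurable (Ω (l + 1)))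
    exact ⟨_, G, ((hv.continuous_conv hU).add continuous_const).continuousOn, hG.continuousOn,
      fun x _ => (hGd x).add_const (b (l + 1)),
      ae_restrict_of_forall_mem (Ω (l + 2)).measurableSet_dom h⟩
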